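/- **Model.** There are $n$ sporadic tasks $\tau_1,\dots,\tau_n$ with distinct fixed priorities; $hp(k)$ and $lp(k)$ are the sets of tasks with higher and lower priority than $\tau_k$. Every job of $\tau_i$ executes $m_i\ge 1$ CPU segments, $2m_i-2$ memory-copy segments and $m_i-1$ GPU segments in the order $$CL_i^0, ML_i^0, G_i^0, ML_i^1, CL_i^1, ML_i^2, G_i^1, ML_i^3,\dots, CL_i^{m_i-1}.$$ A segment becomes available when its job is released and all previous segments of its task (in the same and in earlier jobs) are completed. The execution times of CPU and memory-copy segments lie in $[\check{CL}_i^j,\hat{CL}_i^j]$ and $[\check{ML}_i^j,\hat{ML}_i^j]$, where $0\le\check{CL}_i^j\le\hat{CL}_i^j$, $0\le\check{ML}_i^j\le\hat{ML}_i^j$ and $\hat{ML}_i^j>0$. Consecutive releases of $\tau_i$ are at least $T_i>0$ apart, and the relative deadline satisfies $D_i\le T_i$. The CPU is a uniprocessor with preemptive fixed-priority scheduling; the bus is work-conserving, non-preemptive and fixed-priority. Task $\tau_i$ has $2GN_i\ge 2$ dedicated virtual SMs, $\sum_i GN_i\le GN$, where $2GN$ is the number of virtual SMs. A GPU segment starts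 as soon as it is available and takes time $(Wa-L)/(2GN_i)+L$, where its work $W$, overhead $L$ and interleaved execution ratio $a$ lie in $[\check{GW}_i^j,\hat{GW}_i^j]$ (with $\check{GW}_i^j\ge0$), $[0,\hat{GL}_i^j]$ and $[1,\alpha_i^j]$. **Bounds.** Let $\check{GR}_i^j=\check{GW}_i^j/(2GN_i)$ and $\hat{GR}_i^j=(\hat{GW}_i^j\alpha_i^j-\hat{GL}_i^j)/(2GN_i)+\hat{GL}_i^j$. The CPU workload function is, for $t\ge0$, $$CW_i^h(t)=\sum_{j=h}^{l}\hat{CL}_i^{j\bmod m_i}+\min\Big(\hat{CL}_i^{(l+1)\bmod m_i},\ t-\sum_{j=h}^{l}\big(\hat{CL}_i^{j\bmod m_i}+CS_i(j)\big)\Big),$$ where $l\ge h-1$ is the largest integer with $\sum_{j=h}^{l}(\hat{CL}_i^{j\bmod m_i}+CS_i(j))\le t$, and, with $r=j\bmod m_i$: $CS_i(j)=\check{ML}_i^{2r}+\check{GR}_i^{r}+\check{ML}_i^{2r+1}$ if $r\ne m_i-1$; $CS_i(j)=T_i-D_i$ if $j=m_i-1$; and otherwise $$CS_i(j)=T_i-\sum_{q=0}^{m_i-1}\hat{CL}_i^q-\sum_{q=0}^{2m_i-3}\check{ML}_i^q-\sum_{q=0}^{m_i-2}\check{GR}_i^q.$$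 The memory-copy workload function $MW_i^h(t)$ is defined in the same way with $\hat{ML}_i$, $2m_i-2$ and $MS_i$ in place of $\hat{CL}_i$, $m_i$ and $CS_i$, where, with $r=j\bmod(2m_i-2)$: if $r\ne 2m_i-3$, then $MS_i(j)=\check{GR}_i^{r/2}$ for even $j$ and $MS_i(j)=\check{CL}_i^{(r+1)/2}$ for odd $j$; if $j=2m_i-3$, then $MS_i(j)=T_i-D_i+\check{CL}_i^{m_i-1}+\check{CL}_i^0$; and otherwise $$MS_i(j)=T_i-\sum_{q=0}^{2m_i-3}\hat{ML}_i^q-\sum_{q=1}^{m_i-2}\check{CL}_i^q-\sum_{q=0}^{m_i-2}\check{GR}_i^q.$$ Let $\hat{MR}_k^j$, $\hat{CR}_k^j$ and $R2_k$ be the smallest nonnegative solutions ($+\infty$ if there is none) of $$\hat{MR}_k^j=\hat{ML}_k^j+\sum_{\tau_i\in hp(k)}\max_{0\le h\le 2m_i-3}MW_i^h(\hat{MR}_k^j)+\max_{\tau_i\in lp(k)}\max_{0\le h\le 2m_i-3}\hat{ML}_i^h,$$ $$\hat{CR}_k^j=\hat{CL}_k^j+\sum_{\tau_i\in hp(k)}\max_{0\le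 h\le m_i-1}CW_i^h(\hat{CR}_k^j),$$ $$R2_k=\sum_{j=0}^{m_k-2}\hat{GR}_k^j+\sum_{j=0}^{2m_k-3}\hat{MR}_k^j+\sum_{j=0}^{m_k-1}\hat{CL}_k^j+\sum_{\tau_i\in hp(k)}\max_{0\le h\le m_i-1}CW_i^h(R2_k)$$ (a maximum over an empty set is $0$), and let $$R1_k=\sum_{j=0}^{m_k-2}\hat{GR}_k^j+\sum_{j=0}^{2m_k-3}\hat{MR}_k^j+\sum_{j=0}^{m_k-1}\hat{CR}_k^j,\qquad R_k=\min(R1_k,R2_k).$$ **Theorem.** In every run of this system in which all jobs of the tasks in $hp(k)$ meet their deadlines, every job of $\tau_k$ whose predecessor (if any) is completed by the time of its release finishes at most $R_k$ after its release. In particular, if $R_k\le T_k$, then in every such run every job of $\tau_k$ finishes at most $R_k$ after its release; that is, the worst-case end-to-end response time of $\tau_k$ is at most $R_k$. -/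

import Mathlib

namespace RTGPU

noncomputable section

/-- A CPU-memory-GPU task with `m` CPU segments `0, …, m-1`, `2m-2` memory-copy segments
`0, …, 2m-3` and `m-1` GPU segments `0, …, m-2`, executed in the order
`CL 0, ML 0, G 0, ML 1, CL 1, ML 2, G 1, ML 3, …, CL (m-1)`.
The suffixes `lo` and `up` are the lower and upper bounds of the varying quantities. -/
structure Task where
  /-- number of CPU segments -/
  m : ℕ
  /-- bounds on the execution times of the CPU segments -/
  CLlo : ℕ → ℝ
  CLup : ℕ → ℝ
  /-- bounds on the execution times of the memory-copy segments -/
  MLlo : ℕ → ℝ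
  MLup : ℕ → ℝ
  /-- bounds on the total work of the GPU segments -/
  GWlo : ℕ → ℝ
  GWup : ℕ → ℝ
  /-- upper bounds on the critical-path overheads of the GPU segments -/
  GLup : ℕ → ℝ
  /-- upper bounds on the interleaved execution ratios of the GPU segments -/
  α : ℕ → ℝ
  /-- relative deadline -/
  D : ℝ
  /-- period (minimum inter-arrival time) -/
  T : ℝ
  m_pos : 1 ≤ m
  CL_bounds : ∀ j < m, 0 ≤ CLlo j ∧ CLlo j ≤ CLup j
  ML_bounds : ∀ j < 2 * m - 2, 0 ≤ MLlo j ∧ MLlo j ≤ MLup j ∧ 0 < MLup j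
  GW_bounds : ∀ j < m - 1, 0 ≤ GWlo j ∧ GWlo j ≤ GWup j
  GL_bounds : ∀ j < m - 1, 0 ≤ GLup j
  α_bounds : ∀ j < m - 1, 1 ≤ α j
  T_pos : 0 < T
  D_le_T : D ≤ T

/-- `n` tasks with pairwise distinct priorities (a larger number is a higher priority), on a
platform with one CPU, one bus and `2 * GNtot` virtual SMs, of which `2 * GN i` are dedicated to
task `i`. -/
structure TaskSystem (n : ℕ) where
  task : Fin n → Task
  prio : Fin n → ℕ
  prio_injective : Function.Injective prio
  GNtot : ℕ
  GN : Fin n → ℕ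
  GN_pos : ∀ i, 1 ≤ GN i
  GN_sum : ∑ i, GN i ≤ GNtot

namespace TaskSystem

variable {n : ℕ} (τ : TaskSystem n)

/-! ### The response time bounds -/

/-- The tasks with higher priority than `k`. -/
def hp (k : Fin n) : Finset (Fin n) := Finset.univ.filter fun i => τ.prio k < τ.prio i

/-- The time that a GPU segment takes on the `2 * GN i` dedicated virtual SMs when its total work
is `W`, its critical-path overhead is `L` and its interleaved execution ratio is `a`: the overhead
is incurred once, and the rest of the inflated work `W * a` runs in full parallelism. -/
def gpuTime (i : Fin n) (W L a : ℝ) : ℝ := (W * a - L) / (2 * (τ.GN i : ℝ)) + L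

def GRlo (i : Fin n) (j : ℕ) : ℝ := (τ.task i).GWlo j / (2 * (τ.GN i : ℝ))

def GRup (i : Fin n) (j : ℕ) : ℝ :=
  ((τ.task i).GWup j * (τ.task i).α j - (τ.task i).GLup j) / (2 * (τ.GN i : ℝ))
    + (τ.task i).GLup j

/-- The common shape of the workload functions, for execution lengths `C j` and minimum
separations `S j` (separation between the segments `j` and `j + 1`). The number `N` of complete
terms is `l - h + 1`, where `l` is the largest integer with `∑_{j=h}^{l} (C j + S j) ≤ t`. -/
def workload (C S : ℕ → ℝ) (h : ℕ) (t : ℝ) : ℝ :=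
  let N : ℕ := sSup {N : ℕ | ∑ j ∈ Finset.range N, (C (h + j) + S (h + j)) ≤ t}
  ∑ j ∈ Finset.range N, C (h + j)
    + min (C (h + N)) (t - ∑ j ∈ Finset.range N, (C (h + j) + S (h + j)))

/-- Minimum separation on the bus between the memory-copy segments `j` and `j + 1` of task `i`
(numbered consecutively over successive jobs). -/
def MS (i : Fin n) (j : ℕ) : ℝ :=
  let v := τ.task i
  if j % (2 * v.m - 2) ≠ 2 * v.m - 3 then
    if j % 2 = 0 then τ.GRlo i ((j % (2 * v.m - 2)) / 2)
    else v.CLlo ((j % (2 * v.m - 2) + 1) / 2)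
  else if j = 2 * v.m - 3 then v.T - v.D + v.CLlo (v.m - 1) + v.CLlo 0
  else v.T - ∑ q ∈ Finset.range (2 * v.m - 2), v.MLup q
    - ∑ q ∈ Finset.Ico 1 (v.m - 1), v.CLlo q - ∑ q ∈ Finset.range (v.m - 1), τ.GRlo i q

/-- The memory-copy workload function. -/
def MW (i : Fin n) (h : ℕ) (t : ℝ) : ℝ :=
  workload (fun j => (τ.task i).MLup (j % (2 * (τ.task i).m - 2))) (τ.MS i) h t

/-- Minimum separation on the CPU between the CPU segments `j` and `j + 1` of task `i`
(numbered consecutively over successive jobs). -/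
def CS (i : Fin n) (j : ℕ) : ℝ :=
  let v := τ.task i
  if j % v.m ≠ v.m - 1 then
    v.MLlo (2 * (j % v.m)) + τ.GRlo i (j % v.m) + v.MLlo (2 * (j % v.m) + 1)
  else if j = v.m - 1 then v.T - v.D
  else v.T - ∑ q ∈ Finset.range v.m, v.CLup q
    - ∑ q ∈ Finset.range (2 * v.m - 2), v.MLlo q - ∑ q ∈ Finset.range (v.m - 1), τ.GRlo i q

/-- The CPU workload function. -/
def CW (i : Fin n) (h : ℕ) (t : ℝ) : ℝ :=
  workload (fun j => (τ.task i).CLup (j % (τ.task i).m)) (τ.CS i) h t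

/-- The longest memory-copy segment of the tasks with lower priority than `k`
(`0` if there is none). -/
def blocking (k : Fin n) : ℝ :=
  ⨆ i : {i : Fin n // τ.prio i < τ.prio k}, ⨆ h : Fin (2 * (τ.task i).m - 2), (τ.task i).MLup h

/-- The memory-copy interference of the higher-priority tasks of `k` over a duration `t`
(a task without memory-copy segments contributes the empty supremum `0`). -/
def copyInterference (k : Fin n) (t : ℝ) : ℝ :=
  ∑ i ∈ τ.hp k, ⨆ h : Fin (2 * (τ.task i).m - 2), τ.MW i h t

/-- The CPU interference of the higher-priority tasks of `k` over a duration `t`. -/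
def cpuInterference (k : Fin n) (t : ℝ) : ℝ :=
  ∑ i ∈ τ.hp k, ⨆ h : Fin (τ.task i).m, τ.CW i h t

/-- The smallest duration `x` with `x = F x`; it is `⊤` if there is no such duration. -/
def leastSolution (F : ℝ → EReal) : EReal := sInf {y | ∃ x : ℝ, 0 ≤ x ∧ (x : EReal) = F x ∧ y = x}

def MRup (k : Fin n) (j : ℕ) : EReal :=
  leastSolution fun x => (((τ.task k).MLup j + τ.copyInterference k x + τ.blocking k : ℝ) : EReal)

def CRup (k : Fin n) (j : ℕ) : EReal :=
  leastSolution fun x => (((τ.task k).CLup j + τ.cpuInterference k x : ℝ) : EReal)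

def R1 (k : Fin n) : EReal :=
  ((∑ j ∈ Finset.range ((τ.task k).m - 1), τ.GRup k j : ℝ) : EReal)
    + ∑ j ∈ Finset.range (2 * (τ.task k).m - 2), τ.MRup k j
    + ∑ j ∈ Finset.range (τ.task k).m, τ.CRup k j

def R2 (k : Fin n) : EReal :=
  leastSolution fun x =>
    ((∑ j ∈ Finset.range ((τ.task k).m - 1), τ.GRup k j : ℝ) : EReal)
      + ∑ j ∈ Finset.range (2 * (τ.task k).m - 2), τ.MRup k j
      + ((∑ j ∈ Finset.range (τ.task k).m, (τ.task k).CLup j : ℝ) : EReal)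
      + (τ.cpuInterference k x : EReal)

/-- The end-to-end response time bound. -/
def R (k : Fin n) : EReal := min (τ.R1 k) (τ.R2 k)

end TaskSystem

/-! ### Runs of the system -/

/-- The data of one run. Jobs of a task are numbered `0, 1, 2, …`; task `i` releases the jobs
`a` with `a < numJobs i`. Within a job the segments have the positions `0, …, 4(m-1)`: CPU segment
`j` is at `4 * j`, memory-copy segment `j` at `2 * j + 1` and GPU segment `j` at `4 * j + 2`.
Starting and finishing times are `⊤` for a segment that never starts or never finishes. -/
structure Run (n : ℕ) where
  numJobs : Fin n → ℕ∞
  release : Fin n → ℕ → ℝ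
  /-- actual execution time of CPU segment `j` of job `a` of task `i` -/
  cpuExec : (i : Fin n) → (a : ℕ) → (j : ℕ) → ℝ
  /-- actual execution time of memory-copy segment `j` -/
  copyExec : (i : Fin n) → (a : ℕ) → (j : ℕ) → ℝ
  /-- actual total work, critical-path overhead and interleaved execution ratio
  of GPU segment `j` -/
  gpuWork : (i : Fin n) → (a : ℕ) → (j : ℕ) → ℝ
  gpuOverhead : (i : Fin n) → (a : ℕ) → (j : ℕ) → ℝ
  gpuRatio : (i : Fin n) → (a : ℕ) → (j : ℕ) → ℝ
  /-- time at which memory-copy segment `j` starts on the bus -/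
  copyStart : (i : Fin n) → (a : ℕ) → (j : ℕ) → EReal
  /-- finishing time of the segment at position `p` -/
  finish : (i : Fin n) → (a : ℕ) → (p : ℕ) → EReal

namespace Run

variable {n : ℕ} (τ : TaskSystem n) (σ : Run n)

/-- The finishing time of a job: that of its last segment. -/
def jobFinish (i : Fin n) (a : ℕ) : EReal := σ.finish i a (4 * ((τ.task i).m - 1))

/-- The time at which a segment becomes available: all previous segments of its task (in the same
job and in earlier jobs) are completed and its job is released. -/
def avail (i : Fin n) : (a : ℕ) → (p : ℕ) → EReal
  | 0, 0 => (σ.release i 0 : EReal)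
  | a + 1, 0 => max (σ.release i (a + 1) : EReal) (σ.jobFinish τ i a)
  | a, p + 1 => σ.finish i a p

/-- Task `i` has an available, uncompleted CPU segment at time `t`. -/
def CpuPending (i : Fin n) (t : ℝ) : Prop :=
  ∃ a j : ℕ, (a : ℕ∞) < σ.numJobs i ∧ j < (τ.task i).m ∧
    σ.avail τ i a (4 * j) ≤ (t : EReal) ∧ (t : EReal) < σ.finish i a (4 * j)

/-- The CPU executes task `i` at time `t`: preemptive fixed-priority scheduling. -/
def CpuRuns (i : Fin n) (t : ℝ) : Prop :=
  σ.CpuPending τ i t ∧ ∀ i' ∈ τ.hp i, ¬ σ.CpuPending τ i' t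

/-- The amount of CPU time that task `i` gets from time `s` until time `t`. -/
def cpuService (i : Fin n) (s : EReal) (t : ℝ) : ℝ :=
  MeasureTheory.volume.real {u : ℝ | s ≤ (u : EReal) ∧ u < t ∧ σ.CpuRuns τ i u}

/-- Memory-copy segment `j` of job `a` of task `i` occurs in the run. -/
def IsCopy (i : Fin n) (a j : ℕ) : Prop := (a : ℕ∞) < σ.numJobs i ∧ j < 2 * (τ.task i).m - 2

/-- The run is one that the task system can produce under federated scheduling on the virtual
SMs, preemptive fixed-priority scheduling on the CPU and non-preemptive fixed-priority scheduling
on the bus. -/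
structure Legal : Prop where
  sporadic : ∀ (i : Fin n) (a : ℕ), ((a + 1 : ℕ) : ℕ∞) < σ.numJobs i →
    σ.release i a + (τ.task i).T ≤ σ.release i (a + 1)
  cpuExec_mem : ∀ (i : Fin n) (a j : ℕ), (a : ℕ∞) < σ.numJobs i → j < (τ.task i).m →
    σ.cpuExec i a j ∈ Set.Icc ((τ.task i).CLlo j) ((τ.task i).CLup j)
  copyExec_mem : ∀ (i : Fin n) (a j : ℕ), σ.IsCopy τ i a j →
    σ.copyExec i a j ∈ Set.Icc ((τ.task i).MLlo j) ((τ.task i).MLup j)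
  gpu_mem : ∀ (i : Fin n) (a j : ℕ), (a : ℕ∞) < σ.numJobs i → j < (τ.task i).m - 1 →
    σ.gpuWork i a j ∈ Set.Icc ((τ.task i).GWlo j) ((τ.task i).GWup j) ∧
    σ.gpuOverhead i a j ∈ Set.Icc 0 ((τ.task i).GLup j) ∧
    σ.gpuRatio i a j ∈ Set.Icc 1 ((τ.task i).α j)
  /-- a CPU segment finishes as soon as it has received its execution time -/
  cpu_finish : ∀ (i : Fin n) (a j : ℕ), (a : ℕ∞) < σ.numJobs i → j < (τ.task i).m →
    σ.finish i a (4 * j) = sInf {y : EReal | ∃ t : ℝ, σ.avail τ i a (4 * j) ≤ (t : EReal) ∧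
      σ.cpuExec i a j ≤ σ.cpuService τ i (σ.avail τ i a (4 * j)) t ∧ y = t}
  /-- a GPU segment starts at once on its dedicated virtual SMs -/
  gpu_finish : ∀ (i : Fin n) (a j : ℕ), (a : ℕ∞) < σ.numJobs i → j < (τ.task i).m - 1 →
    σ.finish i a (4 * j + 2) = σ.avail τ i a (4 * j + 2) +
      (τ.gpuTime i (σ.gpuWork i a j) (σ.gpuOverhead i a j) (σ.gpuRatio i a j) : EReal)
  copy_avail : ∀ (i : Fin n) (a j : ℕ), σ.IsCopy τ i a j →
    σ.avail τ i a (2 * j + 1) ≤ σ.copyStart i a j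
  /-- memory copies are not preempted -/
  copy_finish : ∀ (i : Fin n) (a j : ℕ), σ.IsCopy τ i a j →
    σ.finish i a (2 * j + 1) = σ.copyStart i a j + (σ.copyExec i a j : EReal)
  /-- the bus performs one memory copy at a time -/
  copy_exclusive : ∀ (i : Fin n) (a j : ℕ) (i' : Fin n) (a' j' : ℕ),
    σ.IsCopy τ i a j → σ.IsCopy τ i' a' j' → (i, a, j) ≠ (i', a', j') →
    σ.finish i a (2 * j + 1) ≤ σ.copyStart i' a' j' ∨
      σ.finish i' a' (2 * j' + 1) ≤ σ.copyStart i a j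
  /-- the bus does not idle while a memory-copy segment is waiting -/
  copy_work_conserving : ∀ (i : Fin n) (a j : ℕ), σ.IsCopy τ i a j → ∀ t : ℝ,
    σ.avail τ i a (2 * j + 1) ≤ (t : EReal) → (t : EReal) < σ.copyStart i a j →
    ∃ (i' : Fin n) (a' j' : ℕ), σ.IsCopy τ i' a' j' ∧
      σ.copyStart i' a' j' ≤ (t : EReal) ∧ (t : EReal) < σ.finish i' a' (2 * j' + 1)
  /-- no memory-copy segment starts while one of higher priority is waiting -/
  copy_priority : ∀ (i : Fin n) (a j : ℕ) (i' : Fin n) (a' j' : ℕ),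
    σ.IsCopy τ i a j → σ.IsCopy τ i' a' j' → i' ∈ τ.hp i →
    ¬ (σ.avail τ i' a' (2 * j' + 1) ≤ σ.copyStart i a j ∧
      σ.copyStart i a j < σ.copyStart i' a' j')

/-- All jobs of task `i` meet their deadlines in the run. -/
def MeetsDeadlines (i : Fin n) : Prop :=
  ∀ a : ℕ, (a : ℕ∞) < σ.numJobs i →
    σ.jobFinish τ i a ≤ ((σ.release i a + (τ.task i).D : ℝ) : EReal)

end Run

end

end RTGPU

namespace RTGPU

open MeasureTheory TaskSystem

/-! ### Workload functions bound the demand of a segment sequence -/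

/-! The core is one estimate: in every window of length `t ≥ 0`, a task that meets its deadlines
uses the CPU (or the bus) for at most the maximum over `h` of its workload function. Take for `h`
the residue of the first segment that finishes after the window opens. If the segment `N` places
later begins inside the window, the idle time is at least the sum of the first `N` separations, so
the use is at most `t` minus that sum; otherwise the use is at most the total length of the first
`N` segments. `le_workload` turns this dichotomy into the bound.

The delicate point is the separation after the last segment of a later job. It is `T` minus maximal
lengths and minimal gaps, and need not bound the actual gap, because the job before it may finish
late. It is correct only in aggregate: `p + 1` jobs after a completed job, the next release is at
least `T - D + p * T` away, and the `p` whole jobs in between use the resource for at most `p` times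
the total segment length. `SegmentPattern.idle_le` carries out this count for an abstract segment
sequence; `cpu_pattern` and `bus_pattern` supply the two instances.

The equations are then handled by contradiction. If a CPU segment were unfinished, or a copy not yet
started, after a solution `x` of its equation, the time accounted for in that window would be less
than the right-hand side at `x`, that is, less than `x`. This works for every solution, so neither
monotonicity of the workload functions nor attainment of the least solution is needed. For copies,
`copy_wait_le` isolates the single blocking segment of lower priority. Adding the bounds per segment
gives `R1`; charging the CPU interference once, over the whole window from the release, gives `R2`.
-/

lemma workload_nonneg {C S : ℕ → ℝ} (hC : ∀ j, 0 ≤ C j) {h : ℕ} {t : ℝ} (ht : 0 ≤ t) :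
    0 ≤ workload C S h t := by
  unfold workload
  simp only
  set X : Set ℕ := {N : ℕ | ∑ j ∈ Finset.range N, (C (h + j) + S (h + j)) ≤ t}
  have hmem : sSup X ∈ X := by
    by_cases hb : BddAbove X
    · exact Nat.sSup_mem ⟨0, by simpa [X] using ht⟩ hb
    · rw [Nat.sSup_of_not_bddAbove hb]; simpa [X] using ht
  have h1 : ∑ j ∈ Finset.range (sSup X), (C (h + j) + S (h + j)) ≤ t := hmem
  exact add_nonneg (Finset.sum_nonneg fun j _ => hC _) (le_min (hC _) (by linarith))

/-- If a demand `w` is at most `t` minus the separations before each segment that is reached,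
and at most the total length of the segments before each segment that is not reached,
then the workload function bounds it. -/
lemma le_workload {C S : ℕ → ℝ} {h : ℕ} {t w : ℝ} (ht : 0 ≤ t)
    (hb : BddAbove {N : ℕ | ∑ j ∈ Finset.range N, (C (h + j) + S (h + j)) ≤ t})
    (reach : ℕ → Prop)
    (h1 : ∀ N, reach N → w ≤ t - ∑ j ∈ Finset.range N, S (h + j))
    (h2 : ∀ N, ¬ reach N → w ≤ ∑ j ∈ Finset.range N, C (h + j)) :
    w ≤ workload C S h t := by
  unfold workload
  simp only
  set X : Set ℕ := {N : ℕ | ∑ j ∈ Finset.range N, (C (h + j) + S (h + j)) ≤ t}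
  have hN : ∑ j ∈ Finset.range (sSup X), (C (h + j) + S (h + j)) ≤ t :=
    Nat.sSup_mem (s := X) ⟨0, by simpa [X] using ht⟩ hb
  -- Separations may be negative, so the partial sums need not increase; only maximality of the
  -- index is available, and it suffices.
  have hN1 : t < ∑ j ∈ Finset.range (sSup X + 1), (C (h + j) + S (h + j)) := by
    by_contra hcon
    have hmem : sSup X + 1 ∈ X := not_lt.mp hcon
    have := le_csSup hb hmem
    omega
  set N := sSup X
  rw [← min_add_add_left]
  have hA : reach N → w ≤ ∑ j ∈ Finset.range N, C (h + j)
      + (t - ∑ j ∈ Finset.range N, (C (h + j) + S (h + j))) := by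
    intro hr
    have := h1 N hr
    rw [Finset.sum_add_distrib]
    linarith
  have hB : w ≤ ∑ j ∈ Finset.range N, C (h + j) + C (h + N) := by
    rw [← Finset.sum_range_succ (fun j => C (h + j))]
    by_cases hr : reach (N + 1)
    · have := h1 _ hr
      rw [Finset.sum_add_distrib] at hN1
      linarith
    · exact h2 _ hr
  by_cases hr : reach N
  · exact le_min hB (hA hr)
  · exact le_min hB (by have := h2 N hr; linarith)

/-- The values on the first `K + M` indices have a lower bound, and each further period adds `T >
0`, so `f` tends to infinity even if it is not monotone. This ensures that the `sSup` in `workload`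
is a true maximum. -/
lemma bddAbove_of_add_period {f : ℕ → ℝ} {M K : ℕ} (hM : 0 < M) {T t : ℝ} (hT : 0 < T)
    (hf : ∀ N, K ≤ N → f (N + M) = f N + T) : BddAbove {N : ℕ | f N ≤ t} := by
  have hlow : ∃ c : ℝ, ∀ N < K + M, c ≤ f N := by
    have hfin : (f '' (Set.Iio (K + M))).Finite := (Set.finite_Iio _).image _
    obtain ⟨c, hc⟩ := hfin.bddBelow
    exact ⟨c, fun N hN => hc ⟨N, hN, rfl⟩⟩
  obtain ⟨c, hc⟩ := hlow
  have key : ∀ p N, N < K + M → K ≤ N → c + p * T ≤ f (N + p * M) := by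
    intro p
    induction p with
    | zero => intro N hN _; simpa using hc N hN
    | succ p ih =>
      intro N hN hK
      have h1 := hf (N + p * M) (by omega)
      have h2 := ih N hN hK
      rw [show N + (p + 1) * M = N + p * M + M by ring, h1]
      push_cast
      linarith
  obtain ⟨P, hP⟩ := exists_nat_gt ((t - c) / T)
  -- An index beyond this one lies at least `P` full periods above a base index, where `f` is at
  -- least `c + P * T > t`.
  refine ⟨K + P * M, fun N (hN : f N ≤ t) => ?_⟩
  by_contra hcon
  have hlt : K + P * M < N := not_le.mp hcon
  set p := (N - K) / M
  have hdiv : M * p + (N - K) % M = N - K := Nat.div_add_mod _ _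
  have hmod : (N - K) % M < M := Nat.mod_lt _ hM
  have hp : P ≤ p := (Nat.le_div_iff_mul_le hM).2 (by omega)
  have h1 := key p (K + (N - K) % M) (by omega) (by omega)
  rw [show K + (N - K) % M + p * M = N by rw [mul_comm p M]; omega] at h1
  have h2 : (t - c) < P * T := (div_lt_iff₀ hT).1 hP
  have h3 : (P : ℝ) * T ≤ p * T := by gcongr
  linarith

/-! ### Abstract segment sequences on a shared resource -/

/-- A sequence of segments `q` (the valid ones form an initial part of `ℕ`), `M` of them per job,
that occupy a resource during `U`. Segment `q` uses it only in `[A q, F q)`, for at most `C q`. -/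
structure SegmentPattern (M : ℕ) (C S : ℕ → ℝ) (T : ℝ) (valid : ℕ → Prop) (A F : ℕ → ℝ)
    (U : Set ℝ) : Prop where
  M_pos : 0 < M
  T_pos : 0 < T
  C_nonneg : ∀ q, 0 ≤ C q
  C_periodic : ∀ q, C (q + M) = C q
  S_periodic : ∀ q, M ≤ q → S (q + M) = S q
  sum_period : ∑ r ∈ Finset.range M, (C r + S (M + r)) = T
  valid_of_succ : ∀ q, valid (q + 1) → valid q
  A_le_F : ∀ q, valid q → A q ≤ F q
  F_le_A : ∀ q, valid (q + 1) → F q ≤ A (q + 1)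
  gap : ∀ q q', q % M = q' % M → q % M ≠ M - 1 → valid (q + 1) → F q + S q' ≤ A (q + 1)
  far : ∀ a p : ℕ, valid ((a + p + 1) * M) →
    F (a * M + (M - 1)) + S (M - 1) + p * T ≤ A ((a + p + 1) * M)
  subset : ∀ u ∈ U, ∃ q, valid q ∧ A q ≤ u ∧ u < F q
  use_le : ∀ q, valid q → volume.real (U ∩ Set.Ico (A q) (F q)) ≤ C q

namespace SegmentPattern

variable {M : ℕ} {C S : ℕ → ℝ} {T : ℝ} {valid : ℕ → Prop} {A F : ℕ → ℝ} {U : Set ℝ}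

section

variable (P : SegmentPattern M C S T valid A F U)
include P

lemma valid_mono {q q' : ℕ} (h : q ≤ q') (hv : valid q') : valid q := by
  induction q', h using Nat.le_induction with
  | base => exact hv
  | succ q' _ ih => exact ih (P.valid_of_succ _ hv)

lemma A_mono {q q' : ℕ} (h : q ≤ q') (hv : valid q') : A q ≤ A q' := by
  induction q', h using Nat.le_induction with
  | base => exact le_rfl
  | succ q' _ ih =>
    have hv' := P.valid_of_succ _ hv
    exact (ih hv').trans ((P.A_le_F _ hv').trans (P.F_le_A _ hv))

lemma F_le_A_of_lt {q q' : ℕ} (h : q < q') (hv : valid q') : F q ≤ A q' :=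
  (P.F_le_A q (P.valid_mono h hv)).trans (P.A_mono h hv)

lemma F_mono {q q' : ℕ} (h : q ≤ q') (hv : valid q') : F q ≤ F q' := by
  rcases h.eq_or_lt with rfl | h
  · exact le_rfl
  · exact (P.F_le_A_of_lt h hv).trans (P.A_le_F _ hv)

end

end SegmentPattern

/-! ### Measure of the use of a resource on half-open intervals -/

lemma volume_real_Ico_inter_le_add {U : Set ℝ} {s x y : ℝ} :
    volume.real (U ∩ Set.Ico s y)
      ≤ volume.real (U ∩ Set.Ico s x) + volume.real (U ∩ Set.Ico x y) := by
  refine le_trans (measureReal_mono ?_ ?_) (measureReal_union_le _ _)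
  · rintro u ⟨hu, h1, h2⟩
    rcases lt_or_ge u x with h | h
    · exact Or.inl ⟨hu, h1, h⟩
    · exact Or.inr ⟨hu, h, h2⟩
  · refine ((measure_mono (t := Set.Ico s x ∪ Set.Ico x y) ?_).trans_lt ?_).ne
    · exact Set.union_subset_union Set.inter_subset_right Set.inter_subset_right
    · exact (measure_union_le _ _).trans_lt (by simp)

lemma volume_real_inter_Ico_le {U : Set ℝ} {x y : ℝ} (h : x ≤ y) :
    volume.real (U ∩ Set.Ico x y) ≤ y - x := by
  refine (measureReal_mono (Set.inter_subset_right) (by simp)).trans ?_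
  rw [Real.volume_real_Ico_of_le h]

lemma volume_real_inter_Ico_mono {U V : Set ℝ} {x y x' y' : ℝ}
    (h : U ∩ Set.Ico x y ⊆ V ∩ Set.Ico x' y') :
    volume.real (U ∩ Set.Ico x y) ≤ volume.real (V ∩ Set.Ico x' y') :=
  measureReal_mono h ((measure_mono Set.inter_subset_right).trans_lt (by simp)).ne

/-! ### Idle time and use in a window -/

namespace SegmentPattern

variable {M : ℕ} {C S : ℕ → ℝ} {T : ℝ} {valid : ℕ → Prop} {A F : ℕ → ℝ} {U : Set ℝ}

section

variable (P : SegmentPattern M C S T valid A F U)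
include P

lemma C_periodic_mul (p q : ℕ) : C (p * M + q) = C q := by
  induction p with
  | zero => simp
  | succ p ih => rw [show (p + 1) * M + q = p * M + q + M by ring, P.C_periodic, ih]

lemma S_periodic_mul (p q : ℕ) (hq : M ≤ q) : S (p * M + q) = S q := by
  induction p with
  | zero => simp
  | succ p ih =>
    rw [show (p + 1) * M + q = p * M + q + M by ring, P.S_periodic _ (by omega), ih]

/-- The sum starts at index `M` because the separation at `M - 1`, after the first job, is
exceptional; from `M` on the separations are periodic and complement the lengths to `T`. -/
lemma sum_S_period (p : ℕ) :
    ∑ j ∈ Finset.range (p * M), S (M + j) = p * (T - ∑ r ∈ Finset.range M, C r) := by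
  induction p with
  | zero => simp
  | succ p ih =>
    have h : ∑ j ∈ Finset.range M, S (M + (p * M + j)) = ∑ j ∈ Finset.range M, S (M + j) := by
      refine Finset.sum_congr rfl fun j _ => ?_
      rw [show M + (p * M + j) = p * M + (M + j) by ring, P.S_periodic_mul _ _ (by omega)]
    have hT := P.sum_period
    rw [Finset.sum_add_distrib] at hT
    rw [add_mul, one_mul, Finset.sum_range_add, ih, h]
    push_cast
    linarith

lemma sum_C_period (p q : ℕ) :
    ∑ j ∈ Finset.range (p * M), C (q * M + j) = p * ∑ r ∈ Finset.range M, C r := by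
  induction p with
  | zero => simp
  | succ p ih =>
    have h : ∑ j ∈ Finset.range M, C (q * M + (p * M + j)) = ∑ j ∈ Finset.range M, C j := by
      refine Finset.sum_congr rfl fun j _ => ?_
      rw [P.C_periodic_mul, P.C_periodic_mul]
    rw [add_mul, one_mul, Finset.sum_range_add, ih, h]
    push_cast
    ring

lemma bddAbove_complete (h : ℕ) (t : ℝ) :
    BddAbove {N : ℕ | ∑ j ∈ Finset.range N, (C (h + j) + S (h + j)) ≤ t} := by
  -- With this `K`, the index `h + K = M * (h + 1)` is a job boundary past the exceptional
  -- separation at `M - 1`, so the base case sums one aligned period.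
  refine bddAbove_of_add_period (K := M * (h + 1) - h) P.M_pos P.T_pos fun N hN => ?_
  have hM := P.M_pos
  have hle : h ≤ M * (h + 1) := by nlinarith
  induction N, hN using Nat.le_induction with
  | base =>
    rw [Finset.sum_range_add]
    congr 1
    rw [← P.sum_period]
    refine Finset.sum_congr rfl fun j _ => ?_
    rw [show h + (M * (h + 1) - h + j) = h * M + (M + j) by
      rw [← add_assoc, Nat.add_sub_cancel' hle]; ring, P.S_periodic_mul _ _ (by omega),
      P.C_periodic_mul, add_comm M j, P.C_periodic]
  | succ N hN ih =>
    have hMN : M ≤ h + N := by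
      have : M ≤ M * (h + 1) := Nat.le_mul_of_pos_right _ (by omega)
      omega
    rw [show N + 1 + M = N + M + 1 by ring, Finset.sum_range_succ, ih, Finset.sum_range_succ,
      ← add_assoc h N M, P.C_periodic, P.S_periodic _ hMN]
    ring

section Window

variable {s : ℝ}

/-- The use of the resource in `[s, A (q + d))` exceeds that in `[s, A q)` by at most the lengths
of the segments in between. -/
lemma use_add_le (q d : ℕ) (hv : valid (q + d)) :
    volume.real (U ∩ Set.Ico s (A (q + d)))
      ≤ volume.real (U ∩ Set.Ico s (A q)) + ∑ j ∈ Finset.range d, C (q + j) := by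
  induction d with
  | zero => simp
  | succ d ih =>
    have hv' : valid (q + d) := P.valid_of_succ _ hv
    have h2 : volume.real (U ∩ Set.Ico (A (q + d)) (A (q + (d + 1)))) ≤ C (q + d) := by
      refine le_trans (volume_real_inter_Ico_mono ?_) (P.use_le _ hv')
      rintro u ⟨hu, h1, h2⟩
      refine ⟨hu, h1, ?_⟩
      obtain ⟨q', hq', h3, h4⟩ := P.subset u hu
      have hle : q' ≤ q + d := by
        by_contra hcon
        have := P.A_mono (q := q + (d + 1)) (q' := q') (by omega) hq'
        linarith
      exact h4.trans_le (P.F_mono hle hv')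
    have h3 := volume_real_Ico_inter_le_add (U := U) (s := s) (x := A (q + d))
      (y := A (q + (d + 1)))
    rw [Finset.sum_range_succ]
    linarith [ih hv']

/-- The resource is not used between two consecutive segments. -/
lemma use_gap_le (q : ℕ) (hv : valid (q + 1)) :
    volume.real (U ∩ Set.Ico s (A (q + 1))) ≤ volume.real (U ∩ Set.Ico s (F q)) := by
  refine volume_real_inter_Ico_mono ?_
  rintro u ⟨hu, h1, h2⟩
  refine ⟨hu, h1, ?_⟩
  obtain ⟨q', hq', h3, h4⟩ := P.subset u hu
  have hle : q' ≤ q := by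
    by_contra hcon
    have := P.A_mono (q := q + 1) (q' := q') (by omega) hq'
    linarith
  exact h4.trans_le (P.F_mono hle (P.valid_of_succ _ hv))

/-- For `x ≥ s`, the expression `x - volume.real (U ∩ Set.Ico s x)` is `s` plus the idle time in
`[s, x)`. A gap inside a job is entirely idle. The free index `q'` allows the separation to be read
off in the numbering that starts at the window's first job. -/
lemma idle_step (q q' : ℕ) (hq : q % M = q' % M) (hq' : q % M ≠ M - 1) (hv : valid (q + 1)) :
    F q - volume.real (U ∩ Set.Ico s (F q)) + S q'
      ≤ A (q + 1) - volume.real (U ∩ Set.Ico s (A (q + 1))) := by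
  have h1 := P.gap q q' hq hq' hv
  have h2 := P.use_gap_le (s := s) q hv
  linarith

lemma idle_seg (q : ℕ) (hv : valid q) :
    A q - volume.real (U ∩ Set.Ico s (A q)) ≤ F q - volume.real (U ∩ Set.Ico s (F q)) := by
  have h1 := P.A_le_F q hv
  have h2 := volume_real_Ico_inter_le_add (U := U) (s := s) (x := A q) (y := F q)
  have h3 := volume_real_inter_Ico_le (U := U) h1
  linarith

/-- Idle time up to the end of a segment in the first job of the window. -/
lemma idle_first (a h d : ℕ) (hd : h + d ≤ M - 1) (hv : valid (a * M + h + d))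
    (hs : s ≤ F (a * M + h)) :
    s + ∑ j ∈ Finset.range d, S (h + j)
      ≤ F (a * M + h + d) - volume.real (U ∩ Set.Ico s (F (a * M + h + d))) := by
  have hM := P.M_pos
  induction d with
  | zero =>
    have := volume_real_inter_Ico_le (U := U) hs
    simp only [Finset.range_zero, Finset.sum_empty, add_zero]
    linarith
  | succ d ih =>
    have h1 := ih (by omega) (P.valid_of_succ _ hv)
    have hmod : (a * M + h + d) % M = (h + d) % M := by
      rw [add_assoc, Nat.mul_add_mod_self_right]
    have h2 := P.idle_step (s := s) (a * M + h + d) (h + d) hmod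
      (by rw [hmod, Nat.mod_eq_of_lt (by omega)]; omega) hv
    have h3 := P.idle_seg (s := s) _ hv
    rw [Finset.sum_range_succ]
    simp only [← add_assoc] at *
    linarith

/-- Idle time up to a segment of the window. -/
lemma idle_le (a h N : ℕ) (hh : h < M) (hN : 0 < N) (hv : valid (a * M + h + N))
    (hs : s ≤ F (a * M + h)) :
    s + ∑ j ∈ Finset.range N, S (h + j)
      ≤ A (a * M + h + N) - volume.real (U ∩ Set.Ico s (A (a * M + h + N))) := by
  have hM := P.M_pos
  rcases Nat.lt_or_ge (h + N) M with hlt | hge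
  · obtain ⟨d, rfl⟩ : ∃ d, N = d + 1 := ⟨N - 1, by omega⟩
    have h1 := P.idle_first a h d (by omega) (P.valid_of_succ _ hv) hs
    have hmod : (a * M + h + d) % M = (h + d) % M := by
      rw [add_assoc, Nat.mul_add_mod_self_right]
    have h2 := P.idle_step (s := s) (a * M + h + d) (h + d) hmod
      (by rw [hmod, Nat.mod_eq_of_lt (by omega)]; omega) hv
    rw [Finset.sum_range_succ]
    simp only [← add_assoc] at *
    linarith
  · obtain ⟨p, d, hd, hpd⟩ : ∃ p d, d < M ∧ h + N = (p + 1) * M + d := by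
      refine ⟨(h + N) / M - 1, (h + N) % M, Nat.mod_lt _ hM, ?_⟩
      rw [Nat.sub_add_cancel ((Nat.le_div_iff_mul_le hM).2 (by omega)), mul_comm]
      exact (Nat.div_add_mod _ _).symm
    have hidx : a * M + h + N = (a + p + 1) * M + d := by
      rw [add_assoc, hpd]; ring
    rw [hidx] at hv ⊢
    -- idle time up to the beginning of the last job
    have hv0 : valid ((a + p + 1) * M) := P.valid_mono (by omega) hv
    have hlastidx : (a * M + (M - 1)) + 1 = (a + 1) * M := by
      rw [add_assoc, Nat.sub_add_cancel hM]; ring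
    have hbidx : (a + 1) * M + p * M = (a + p + 1) * M := by ring
    have hv1 : valid ((a + 1) * M) := P.valid_mono (by rw [← hbidx]; omega) hv0
    have e1 := P.idle_first (s := s) a h (M - 1 - h) (by omega)
      (P.valid_of_succ _ (by
        rw [show a * M + h + (M - 1 - h) + 1 = (a + 1) * M by rw [← hlastidx]; omega]
        exact hv1)) hs
    rw [show a * M + h + (M - 1 - h) = a * M + (M - 1) by omega] at e1
    have e2 := P.far a p hv0
    have e3 := P.use_gap_le (s := s) (a * M + (M - 1)) (by rw [hlastidx]; exact hv1)
    rw [hlastidx] at e3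
    have e4 := P.use_add_le (s := s) ((a + 1) * M) (p * M) (by rw [hbidx]; exact hv0)
    rw [hbidx, P.sum_C_period] at e4
    have e5 := P.sum_S_period p
    -- The `p` whole jobs span `p * T` and use at most `p * ∑ C`; the difference is the sum of the
    -- separations over these `p` periods. The individual late separations are never compared with
    -- actual gaps.
    have hbase : s + (∑ j ∈ Finset.range (M - 1 - h), S (h + j) + S (M - 1)
        + ∑ j ∈ Finset.range (p * M), S (M + j))
        ≤ A ((a + p + 1) * M) - volume.real (U ∩ Set.Ico s (A ((a + p + 1) * M))) := by
      rw [e5]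
      linarith
    -- idle time in the last job
    have hlast : ∀ d, d < M → valid ((a + p + 1) * M + d) →
        s + (∑ j ∈ Finset.range (M - 1 - h), S (h + j) + S (M - 1)
          + ∑ j ∈ Finset.range (p * M), S (M + j)
          + ∑ j ∈ Finset.range d, S (M + (p * M + j)))
        ≤ A ((a + p + 1) * M + d)
          - volume.real (U ∩ Set.Ico s (A ((a + p + 1) * M + d))) := by
      intro d hd hv
      induction d with
      | zero => simpa using hbase
      | succ d ih =>
        have f1 := ih (by omega) (P.valid_of_succ _ hv)
        have f2 := P.idle_seg (s := s) ((a + p + 1) * M + d) (P.valid_of_succ _ hv)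
        have hmod : ((a + p + 1) * M + d) % M = d := by
          rw [Nat.mul_add_mod_self_right, Nat.mod_eq_of_lt (by omega)]
        have f3 := P.idle_step (s := s) ((a + p + 1) * M + d) (M + (p * M + d)) (by
          rw [hmod, show M + (p * M + d) = (p + 1) * M + d by ring, Nat.mul_add_mod_self_right,
            Nat.mod_eq_of_lt (by omega)]) (by omega) hv
        rw [Finset.sum_range_succ]
        simp only [← add_assoc] at *
        linarith
    refine le_trans (le_of_eq ?_) (hlast d hd hv)
    congr 1
    obtain rfl : N = (M - 1 - h) + 1 + p * M + d := by
      have : (p + 1) * M = p * M + M := by ring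
      omega
    rw [Finset.sum_range_add, Finset.sum_range_add, Finset.sum_range_succ]
    congr 1
    · congr 1
      · congr 2; omega
      · exact Finset.sum_congr rfl fun j _ => by congr 1; omega
    · exact Finset.sum_congr rfl fun j _ => by congr 1; omega

end Window

/-- The use of the resource in a window is at most the workload function from some segment on. -/
theorem exists_use_le_workload (s : ℝ) {t : ℝ} (ht : 0 ≤ t) :
    ∃ h < M, volume.real (U ∩ Set.Ico s (s + t)) ≤ workload C S h t := by
  classical
  have hM := P.M_pos
  by_cases hex : ∃ q, valid q ∧ s < F q
  -- Segments before this one do not meet the window, and its finishing time is beyond `s`, as the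
  -- idle-time count requires.
  · set q₀ := Nat.find hex with hq₀
    obtain ⟨hv₀, hs₀⟩ : valid q₀ ∧ s < F q₀ := Nat.find_spec hex
    have hmin : ∀ q, valid q → s < F q → q₀ ≤ q := fun q h1 h2 => Nat.find_min' hex ⟨h1, h2⟩
    clear_value q₀
    set a := q₀ / M
    set h := q₀ % M
    have hq : q₀ = a * M + h := by rw [mul_comm]; exact (Nat.div_add_mod _ _).symm
    have hh : h < M := Nat.mod_lt _ hM
    -- A segment counts as reached when it exists and begins no later than the end of the window.
    refine ⟨h, hh, le_workload ht (P.bddAbove_complete h t)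
      (fun N => valid (q₀ + N) ∧ A (q₀ + N) ≤ s + t) ?_ ?_⟩
    · rintro N ⟨h1, h2⟩
      rcases Nat.eq_zero_or_pos N with rfl | hN
      · have := volume_real_inter_Ico_le (U := U) (x := s) (y := s + t) (by linarith)
        simp only [Finset.range_zero, Finset.sum_empty]
        linarith
      · rw [hq] at h1 h2 hs₀
        have e1 := P.idle_le a h N hh hN h1 hs₀.le
        have e2 := volume_real_Ico_inter_le_add (U := U) (s := s) (x := A (a * M + h + N))
          (y := s + t)
        have e3 := volume_real_inter_Ico_le (U := U) h2
        linarith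
    · intro N hN
      have hsub : U ∩ Set.Ico s (s + t) ⊆
          ⋃ j ∈ (Finset.range N).filter fun j => valid (q₀ + j), (U ∩ Set.Ico (A (q₀ + j)) (F (q₀ + j))) := by
        rintro u ⟨hu, h1, h2⟩
        obtain ⟨q, hv, h3, h4⟩ := P.subset u hu
        have hle := hmin q hv (h1.trans_lt h4)
        obtain ⟨j, rfl⟩ := Nat.exists_eq_add_of_le hle
        have hj : j < N := by
          by_contra hcon
          exact hN ⟨P.valid_mono (by omega) hv,
            (P.A_mono (q' := q₀ + j) (by omega) hv).trans (by linarith)⟩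
        simp only [Set.mem_iUnion]
        exact ⟨j, Finset.mem_filter.2 ⟨Finset.mem_range.2 hj, hv⟩, hu, h3, h4⟩
      refine (measureReal_mono hsub ?_).trans ((measureReal_biUnion_finset_le _ _).trans ?_)
      · refine ((measure_biUnion_finset_le _ _).trans_lt ?_).ne
        refine ENNReal.sum_lt_top.2 fun j _ => ?_
        exact (measure_mono Set.inter_subset_right).trans_lt (by simp)
      · refine le_trans (Finset.sum_le_sum fun j hj => ?_)
          (Finset.sum_le_sum_of_subset_of_nonneg (Finset.filter_subset _ _)
            fun j _ _ => P.C_nonneg (h + j))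
        refine (P.use_le _ (Finset.mem_filter.1 hj).2).trans (le_of_eq ?_)
        rw [hq, add_assoc, P.C_periodic_mul]
  · refine ⟨0, hM, le_trans (le_of_eq ?_) (workload_nonneg P.C_nonneg ht)⟩
    have : U ∩ Set.Ico s (s + t) = ∅ := by
      refine Set.eq_empty_of_forall_notMem ?_
      rintro u ⟨hu, h1, h2⟩
      obtain ⟨q, hv, h3, h4⟩ := P.subset u hu
      exact hex ⟨q, hv, h1.trans_lt h4⟩
    simp [this]

end

end SegmentPattern

lemma succ_div_mod_of_ne {M q : ℕ} (hM : 0 < M) (h : q % M ≠ M - 1) :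
    (q + 1) / M = q / M ∧ (q + 1) % M = q % M + 1 := by
  have h1 := Nat.div_add_mod q M
  have h2 := Nat.mod_lt q hM
  exact (Nat.div_mod_unique hM).2 ⟨by omega, by omega⟩

lemma sum_range_two_mul (f : ℕ → ℝ) (n : ℕ) :
    ∑ q ∈ Finset.range (2 * n), f q = ∑ r ∈ Finset.range n, (f (2 * r) + f (2 * r + 1)) := by
  induction n with
  | zero => simp
  | succ n ih =>
    rw [show 2 * (n + 1) = 2 * n + 1 + 1 by ring, Finset.sum_range_succ, Finset.sum_range_succ, ih,
      Finset.sum_range_succ]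
    ring

/-! ### Durations of GPU segments -/

namespace TaskSystem

variable {n : ℕ} (τ : TaskSystem n) (i : Fin n)

lemma two_mul_GN_pos : (1 : ℝ) ≤ 2 * (τ.GN i : ℝ) := by
  have : (1 : ℝ) ≤ τ.GN i := by exact_mod_cast τ.GN_pos i
  linarith

lemma GRlo_nonneg {j : ℕ} (hj : j < (τ.task i).m - 1) : 0 ≤ τ.GRlo i j :=
  div_nonneg ((τ.task i).GW_bounds j hj).1 (by positivity)

/-- Since `2 * GN ≥ 1`, the overhead costs at least as much as it saves in the parallel part, so the
duration increases with `L` as well as with `W * a`. -/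
lemma GRlo_le_gpuTime {j : ℕ} (hj : j < (τ.task i).m - 1) {W L a : ℝ}
    (hW : (τ.task i).GWlo j ≤ W) (hL : 0 ≤ L) (ha : 1 ≤ a) :
    τ.GRlo i j ≤ τ.gpuTime i W L a := by
  have h2 := τ.two_mul_GN_pos i
  have h0 := ((τ.task i).GW_bounds j hj).1
  have hWa : (τ.task i).GWlo j ≤ W * a := hW.trans (le_mul_of_one_le_right (h0.trans hW) ha)
  have hL' : L / (2 * (τ.GN i : ℝ)) ≤ L := div_le_self hL h2
  have h3 : (τ.task i).GWlo j / (2 * (τ.GN i : ℝ)) ≤ W * a / (2 * (τ.GN i : ℝ)) :=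
    div_le_div_of_nonneg_right hWa (by linarith)
  rw [GRlo, gpuTime, sub_div]
  linarith

lemma gpuTime_le_GRup {j : ℕ} (hj : j < (τ.task i).m - 1) {W L a : ℝ}
    (hW0 : (τ.task i).GWlo j ≤ W) (hW : W ≤ (τ.task i).GWup j) (hL : L ≤ (τ.task i).GLup j)
    (ha : 1 ≤ a) (ha' : a ≤ (τ.task i).α j) :
    τ.gpuTime i W L a ≤ τ.GRup i j := by
  have h2 := τ.two_mul_GN_pos i
  have h0 := ((τ.task i).GW_bounds j hj).1
  have hWa : W * a ≤ (τ.task i).GWup j * (τ.task i).α j :=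
    mul_le_mul hW ha' (by linarith) (by linarith)
  have hL' : ((τ.task i).GLup j - L) / (2 * (τ.GN i : ℝ)) ≤ (τ.task i).GLup j - L :=
    div_le_self (by linarith) h2
  have h3 : W * a / (2 * (τ.GN i : ℝ))
      ≤ (τ.task i).GWup j * (τ.task i).α j / (2 * (τ.GN i : ℝ)) :=
    div_le_div_of_nonneg_right hWa (by linarith)
  rw [sub_div] at hL'
  rw [GRup, gpuTime, sub_div, sub_div]
  linarith

end TaskSystem

/-! ### Order and finiteness of the times in a legal run -/

namespace Run

variable {n : ℕ} {τ : TaskSystem n} {σ : Run n} {i : Fin n}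

lemma avail_succ (a p : ℕ) : σ.avail τ i a (p + 1) = σ.finish i a p := by
  cases a <;> rfl

lemma position_cases {m p : ℕ} (hm : 1 ≤ m) (hp : p ≤ 4 * (m - 1)) :
    (∃ j < m, p = 4 * j) ∨ (∃ j < m - 1, p = 4 * j + 2) ∨ ∃ j < 2 * m - 2, p = 2 * j + 1 := by
  have h : p % 4 = 0 ∨ p % 4 = 2 ∨ p % 2 = 1 := by omega
  rcases h with h | h | h
  · exact Or.inl ⟨p / 4, by omega, by omega⟩
  · exact Or.inr (Or.inl ⟨p / 4, by omega, by omega⟩)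
  · exact Or.inr (Or.inr ⟨p / 2, by omega, by omega⟩)

lemma cpuService_le {s t : ℝ} (h : s ≤ t) : σ.cpuService τ i (s : EReal) t ≤ t - s := by
  have : {u : ℝ | (s : EReal) ≤ (u : EReal) ∧ u < t ∧ σ.CpuRuns τ i u} ⊆ Set.Ico s t :=
    fun u hu => ⟨EReal.coe_le_coe_iff.1 hu.1, hu.2.1⟩
  refine (measureReal_mono this (by simp)).trans ?_
  rw [Real.volume_real_Ico_of_le h]

lemma cpuService_coe (s t : ℝ) :
    σ.cpuService τ i (s : EReal) t = volume.real ({u | σ.CpuRuns τ i u} ∩ Set.Ico s t) := by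
  unfold cpuService
  congr 1
  ext u
  simp only [EReal.coe_le_coe_iff, Set.mem_ofPred_eq, Set.mem_inter_iff, Set.mem_Ico]
  tauto

namespace Legal

variable (hσ : σ.Legal τ)
include hσ

/-- Service accumulates no faster than time passes, so each time admitted in the infimum defining
the finish is at least the execution time after availability. -/
lemma avail_add_cpuExec_le {a j : ℕ} (ha : (a : ℕ∞) < σ.numJobs i) (hj : j < (τ.task i).m) :
    σ.avail τ i a (4 * j) + (σ.cpuExec i a j : EReal) ≤ σ.finish i a (4 * j) := by
  rw [hσ.cpu_finish i a j ha hj]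
  refine le_sInf ?_
  rintro _ ⟨t, h1, h2, rfl⟩
  induction hA : σ.avail τ i a (4 * j) with
  | bot => simp
  | top => rw [hA] at h1; simp at h1
  | coe A =>
    rw [hA] at h1 h2
    have h3 : A ≤ t := EReal.coe_le_coe_iff.1 h1
    have h4 := h2.trans (cpuService_le h3)
    rw [← EReal.coe_add, EReal.coe_le_coe_iff]
    linarith

lemma avail_add_CLlo_le {a j : ℕ} (ha : (a : ℕ∞) < σ.numJobs i) (hj : j < (τ.task i).m) :
    σ.avail τ i a (4 * j) + ((τ.task i).CLlo j : EReal) ≤ σ.finish i a (4 * j) :=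
  (add_le_add_right (EReal.coe_le_coe_iff.2 (hσ.cpuExec_mem i a j ha hj).1) _).trans
    (hσ.avail_add_cpuExec_le ha hj)

lemma avail_add_GRlo_le {a j : ℕ} (ha : (a : ℕ∞) < σ.numJobs i) (hj : j < (τ.task i).m - 1) :
    σ.avail τ i a (4 * j + 2) + (τ.GRlo i j : EReal) ≤ σ.finish i a (4 * j + 2) := by
  rw [hσ.gpu_finish i a j ha hj]
  obtain ⟨h1, h2, h3⟩ := hσ.gpu_mem i a j ha hj
  exact add_le_add_right (EReal.coe_le_coe_iff.2 (τ.GRlo_le_gpuTime i hj h1.1 h2.1 h3.1)) _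

lemma finish_le_avail_add_GRup {a j : ℕ} (ha : (a : ℕ∞) < σ.numJobs i)
    (hj : j < (τ.task i).m - 1) :
    σ.finish i a (4 * j + 2) ≤ σ.avail τ i a (4 * j + 2) + (τ.GRup i j : EReal) := by
  rw [hσ.gpu_finish i a j ha hj]
  obtain ⟨h1, h2, h3⟩ := hσ.gpu_mem i a j ha hj
  exact add_le_add_right
    (EReal.coe_le_coe_iff.2 (τ.gpuTime_le_GRup i hj h1.1 h1.2 h2.2 h3.1 h3.2)) _

lemma copyStart_add_MLlo_le {a j : ℕ} (hc : σ.IsCopy τ i a j) :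
    σ.copyStart i a j + ((τ.task i).MLlo j : EReal) ≤ σ.finish i a (2 * j + 1) := by
  rw [hσ.copy_finish i a j hc]
  exact add_le_add_right (EReal.coe_le_coe_iff.2 (hσ.copyExec_mem i a j hc).1) _

lemma finish_le_copyStart_add_MLup {a j : ℕ} (hc : σ.IsCopy τ i a j) :
    σ.finish i a (2 * j + 1) ≤ σ.copyStart i a j + ((τ.task i).MLup j : EReal) := by
  rw [hσ.copy_finish i a j hc]
  exact add_le_add_right (EReal.coe_le_coe_iff.2 (hσ.copyExec_mem i a j hc).2) _

lemma copyStart_le_finish {a j : ℕ} (hc : σ.IsCopy τ i a j) :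
    σ.copyStart i a j ≤ σ.finish i a (2 * j + 1) :=
  (le_add_of_nonneg_right (EReal.coe_nonneg.2 ((τ.task i).ML_bounds j hc.2).1)).trans
    (hσ.copyStart_add_MLlo_le hc)

lemma avail_le_finish {a p : ℕ} (ha : (a : ℕ∞) < σ.numJobs i) (hp : p ≤ 4 * ((τ.task i).m - 1)) :
    σ.avail τ i a p ≤ σ.finish i a p := by
  rcases position_cases (τ.task i).m_pos hp with ⟨j, hj, rfl⟩ | ⟨j, hj, rfl⟩ | ⟨j, hj, rfl⟩
  · exact (le_add_of_nonneg_right (EReal.coe_nonneg.2 ((τ.task i).CL_bounds j hj).1)).trans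
      (hσ.avail_add_CLlo_le ha hj)
  · exact (le_add_of_nonneg_right (EReal.coe_nonneg.2 (τ.GRlo_nonneg i hj))).trans
      (hσ.avail_add_GRlo_le ha hj)
  · exact (hσ.copy_avail i a j ⟨ha, hj⟩).trans (hσ.copyStart_le_finish ⟨ha, hj⟩)

lemma finish_mono {a p p' : ℕ} (ha : (a : ℕ∞) < σ.numJobs i) (hpp : p ≤ p')
    (hp : p' ≤ 4 * ((τ.task i).m - 1)) : σ.finish i a p ≤ σ.finish i a p' := by
  induction p', hpp using Nat.le_induction with
  | base => exact le_rfl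
  | succ q _ ih =>
    refine (ih (by omega)).trans ?_
    rw [← avail_succ (τ := τ)]
    exact hσ.avail_le_finish ha hp

lemma finish_le_avail {a p p' : ℕ} (ha : (a : ℕ∞) < σ.numJobs i) (hpp : p < p')
    (hp : p' ≤ 4 * ((τ.task i).m - 1)) : σ.finish i a p ≤ σ.avail τ i a p' := by
  obtain ⟨q, rfl⟩ : ∃ q, p' = q + 1 := ⟨p' - 1, by omega⟩
  rw [avail_succ]
  exact hσ.finish_mono ha (by omega) (by omega)

lemma release_le_avail {a p : ℕ} (ha : (a : ℕ∞) < σ.numJobs i)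
    (hp : p ≤ 4 * ((τ.task i).m - 1)) : (σ.release i a : EReal) ≤ σ.avail τ i a p := by
  induction p with
  | zero =>
    cases a with
    | zero => exact le_rfl
    | succ a => exact le_max_left _ _
  | succ p ih =>
    rw [avail_succ]
    exact (ih (by omega)).trans (hσ.avail_le_finish ha (by omega))

lemma release_add_mul_le {a : ℕ} (d : ℕ) (ha : ((a + d : ℕ) : ℕ∞) < σ.numJobs i) :
    σ.release i a + d * (τ.task i).T ≤ σ.release i (a + d) := by
  induction d with
  | zero => simp
  | succ d ih =>
    have h1 := ih (lt_of_le_of_lt (by exact_mod_cast Nat.le_succ _) ha)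
    have h2 := hσ.sporadic i (a + d) ha
    rw [← add_assoc a d 1]
    push_cast
    linarith

section Deadlines

variable (hd : σ.MeetsDeadlines τ i)
include hd

/-- Every segment finishes between the release and the deadline of its job, so the extended real is
finite and the segment sequence can be described by real numbers. -/
lemma finish_coe {a p : ℕ} (ha : (a : ℕ∞) < σ.numJobs i) (hp : p ≤ 4 * ((τ.task i).m - 1)) :
    ((σ.finish i a p).toReal : EReal) = σ.finish i a p := by
  refine EReal.coe_toReal ?_ ?_
  · exact (((hσ.finish_mono ha hp le_rfl).trans (hd a ha)).trans_lt (EReal.coe_lt_top _)).ne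
  · exact ((EReal.bot_lt_coe _).trans_le
      ((hσ.release_le_avail ha hp).trans (hσ.avail_le_finish ha hp))).ne'

lemma avail_coe {a p : ℕ} (ha : (a : ℕ∞) < σ.numJobs i) (hp : p ≤ 4 * ((τ.task i).m - 1)) :
    ((σ.avail τ i a p).toReal : EReal) = σ.avail τ i a p := by
  refine EReal.coe_toReal ?_ ?_
  · exact ((hσ.avail_le_finish ha hp).trans_lt
      (by rw [← hσ.finish_coe hd ha hp]; exact EReal.coe_lt_top _)).ne
  · exact ((EReal.bot_lt_coe _).trans_le (hσ.release_le_avail ha hp)).ne'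

lemma copyStart_coe {a j : ℕ} (hc : σ.IsCopy τ i a j) :
    ((σ.copyStart i a j).toReal : EReal) = σ.copyStart i a j := by
  have hp : 2 * j + 1 ≤ 4 * ((τ.task i).m - 1) := by have := hc.2; omega
  refine EReal.coe_toReal ?_ ?_
  · exact ((hσ.copyStart_le_finish hc).trans_lt
      (by rw [← hσ.finish_coe hd hc.1 hp]; exact EReal.coe_lt_top _)).ne
  · exact ((EReal.bot_lt_coe _).trans_le
      ((hσ.release_le_avail hc.1 hp).trans (hσ.copy_avail i a j hc))).ne'

/-- The deadline leaves `T - D` until the earliest next release, and each further job adds `T`. This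
is the source of the aggregate separation between jobs. -/
lemma jobFinish_le_release {a : ℕ} (d : ℕ) (ha : ((a + d + 1 : ℕ) : ℕ∞) < σ.numJobs i) :
    σ.jobFinish τ i a + (((τ.task i).T - (τ.task i).D + d * (τ.task i).T : ℝ) : EReal)
      ≤ (σ.release i (a + d + 1) : EReal) := by
  have h1 := hσ.release_add_mul_le (a := a) (d + 1) ha
  have ha' : (a : ℕ∞) < σ.numJobs i :=
    lt_of_le_of_lt (by exact_mod_cast (by omega : a ≤ a + d + 1)) ha
  refine (add_le_add_left (hd a ha') _).trans ?_
  rw [← EReal.coe_add, EReal.coe_le_coe_iff, add_assoc a d 1]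
  push_cast at h1
  linarith

end Deadlines

end Legal

end Run

/-! ### Periodicity and period sums of the separations -/

namespace TaskSystem

variable {n : ℕ} (τ : TaskSystem n) (i : Fin n)

lemma CS_of_ne {j : ℕ} (h : j % (τ.task i).m ≠ (τ.task i).m - 1) :
    τ.CS i j = (τ.task i).MLlo (2 * (j % (τ.task i).m)) + τ.GRlo i (j % (τ.task i).m)
      + (τ.task i).MLlo (2 * (j % (τ.task i).m) + 1) := by
  simp [CS, h]

lemma CS_first : τ.CS i ((τ.task i).m - 1) = (τ.task i).T - (τ.task i).D := by
  have h : ((τ.task i).m - 1) % (τ.task i).m = (τ.task i).m - 1 :=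
    Nat.mod_eq_of_lt (by have := (τ.task i).m_pos; omega)
  simp [CS, h]

lemma CS_late {j : ℕ} (h : j % (τ.task i).m = (τ.task i).m - 1) (hj : j ≠ (τ.task i).m - 1) :
    τ.CS i j = (τ.task i).T - ∑ q ∈ Finset.range (τ.task i).m, (τ.task i).CLup q
      - ∑ q ∈ Finset.range (2 * (τ.task i).m - 2), (τ.task i).MLlo q
      - ∑ q ∈ Finset.range ((τ.task i).m - 1), τ.GRlo i q := by
  simp [CS, h, hj]

lemma CS_add_m {j : ℕ} (hj : (τ.task i).m ≤ j) : τ.CS i (j + (τ.task i).m) = τ.CS i j := by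
  have hm := (τ.task i).m_pos
  by_cases h : j % (τ.task i).m = (τ.task i).m - 1
  · rw [τ.CS_late i (by rwa [Nat.add_mod_right]) (by omega), τ.CS_late i h (by omega)]
  · rw [τ.CS_of_ne i (by rwa [Nat.add_mod_right]), τ.CS_of_ne i h, Nat.add_mod_right]

/-- The late separation is exactly what completes the maximal segment lengths and the minimal gaps
within a job to one period. -/
lemma sum_CS_period :
    ∑ r ∈ Finset.range (τ.task i).m,
      ((τ.task i).CLup (r % (τ.task i).m) + τ.CS i ((τ.task i).m + r)) = (τ.task i).T := by
  obtain ⟨g, hg⟩ : ∃ g, (τ.task i).m = g + 1 :=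
    ⟨(τ.task i).m - 1, by have := (τ.task i).m_pos; omega⟩
  have hlast : τ.CS i (g + 1 + g) = (τ.task i).T
      - ∑ q ∈ Finset.range (g + 1), (τ.task i).CLup q
      - ∑ q ∈ Finset.range (2 * g), (τ.task i).MLlo q - ∑ q ∈ Finset.range g, τ.GRlo i q := by
    have := τ.CS_late i (j := g + 1 + g) (by
      rw [hg, Nat.add_mod_left, Nat.mod_eq_of_lt (by omega)]; omega) (by omega)
    rw [this, hg]
    rfl
  have hS : ∀ r ∈ Finset.range g, τ.CS i (g + 1 + r) =
      ((τ.task i).MLlo (2 * r) + (τ.task i).MLlo (2 * r + 1)) + τ.GRlo i r := by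
    intro r hr
    have hr' := Finset.mem_range.1 hr
    have hmod : (g + 1 + r) % (τ.task i).m = r := by
      rw [hg, Nat.add_mod_left, Nat.mod_eq_of_lt (by omega)]
    rw [τ.CS_of_ne i (by rw [hmod]; omega), hmod]
    ring
  have hC : ∀ r ∈ Finset.range (g + 1), (τ.task i).CLup (r % (g + 1)) = (τ.task i).CLup r :=
    fun r hr => by rw [Nat.mod_eq_of_lt (Finset.mem_range.1 hr)]
  rw [hg, Finset.sum_add_distrib, Finset.sum_congr rfl hC,
    Finset.sum_range_succ (fun r => τ.CS i (g + 1 + r)), Finset.sum_congr rfl hS, hlast,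
    Finset.sum_add_distrib, sum_range_two_mul]
  ring

lemma MS_of_even {j : ℕ} (h : j % (2 * (τ.task i).m - 2) ≠ 2 * (τ.task i).m - 3)
    (h2 : j % 2 = 0) : τ.MS i j = τ.GRlo i ((j % (2 * (τ.task i).m - 2)) / 2) := by
  simp [MS, h, h2]

lemma MS_of_odd {j : ℕ} (h : j % (2 * (τ.task i).m - 2) ≠ 2 * (τ.task i).m - 3)
    (h2 : j % 2 = 1) :
    τ.MS i j = (τ.task i).CLlo ((j % (2 * (τ.task i).m - 2) + 1) / 2) := by
  simp [MS, h, h2]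

lemma MS_first (hm : 2 ≤ (τ.task i).m) : τ.MS i (2 * (τ.task i).m - 3)
    = (τ.task i).T - (τ.task i).D + (τ.task i).CLlo ((τ.task i).m - 1) + (τ.task i).CLlo 0 := by
  have h : (2 * (τ.task i).m - 3) % (2 * (τ.task i).m - 2) = 2 * (τ.task i).m - 3 :=
    Nat.mod_eq_of_lt (by omega)
  simp [MS, h]

lemma MS_late {j : ℕ} (h : j % (2 * (τ.task i).m - 2) = 2 * (τ.task i).m - 3)
    (hj : j ≠ 2 * (τ.task i).m - 3) :
    τ.MS i j = (τ.task i).T - ∑ q ∈ Finset.range (2 * (τ.task i).m - 2), (τ.task i).MLup q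
      - ∑ q ∈ Finset.Ico 1 ((τ.task i).m - 1), (τ.task i).CLlo q
      - ∑ q ∈ Finset.range ((τ.task i).m - 1), τ.GRlo i q := by
  simp [MS, h, hj]

lemma mod_copies_mod_two (m j : ℕ) : j % (2 * m - 2) % 2 = j % 2 :=
  Nat.mod_mod_of_dvd j ⟨m - 1, by omega⟩

lemma MS_add (hm : 2 ≤ (τ.task i).m) {j : ℕ} (hj : 2 * (τ.task i).m - 2 ≤ j) :
    τ.MS i (j + (2 * (τ.task i).m - 2)) = τ.MS i j := by
  by_cases h : j % (2 * (τ.task i).m - 2) = 2 * (τ.task i).m - 3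
  · rw [τ.MS_late i (by rwa [Nat.add_mod_right]) (by omega), τ.MS_late i h (by omega)]
  · rcases Nat.mod_two_eq_zero_or_one j with h2 | h2
    · rw [τ.MS_of_even i (by rwa [Nat.add_mod_right]) (by omega), τ.MS_of_even i h h2,
        Nat.add_mod_right]
    · rw [τ.MS_of_odd i (by rwa [Nat.add_mod_right]) (by omega), τ.MS_of_odd i h h2,
        Nat.add_mod_right]

lemma sum_MS_period (hm : 2 ≤ (τ.task i).m) :
    ∑ r ∈ Finset.range (2 * (τ.task i).m - 2),
      ((τ.task i).MLup (r % (2 * (τ.task i).m - 2)) + τ.MS i (2 * (τ.task i).m - 2 + r))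
      = (τ.task i).T := by
  obtain ⟨g, hg⟩ : ∃ g, (τ.task i).m = g + 2 := ⟨(τ.task i).m - 2, by omega⟩
  have hM : 2 * (τ.task i).m - 2 = 2 * g + 2 := by omega
  have hM' : 2 * (τ.task i).m - 3 = 2 * g + 1 := by omega
  have hm' : (τ.task i).m - 1 = g + 1 := by omega
  have hmod : ∀ r < 2 * g + 2, (2 * g + 2 + r) % (2 * (τ.task i).m - 2) = r := by
    intro r hr
    rw [hM, Nat.add_mod_left, Nat.mod_eq_of_lt hr]
  have hlast : τ.MS i (2 * g + 2 + (2 * g + 1)) = (τ.task i).T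
      - ∑ q ∈ Finset.range (2 * g + 2), (τ.task i).MLup q
      - ∑ q ∈ Finset.range g, (τ.task i).CLlo (q + 1)
      - ∑ q ∈ Finset.range (g + 1), τ.GRlo i q := by
    rw [τ.MS_late i (by rw [hmod _ (by omega)]; omega) (by omega), hM, hm',
      Finset.sum_Ico_eq_sum_range]
    simp [add_comm]
  have hE : ∀ r ≤ g, τ.MS i (2 * g + 2 + 2 * r) = τ.GRlo i r := by
    intro r hr
    rw [τ.MS_of_even i (by rw [hmod _ (by omega)]; omega) (by omega), hmod _ (by omega)]
    congr 1
    omega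
  have hO : ∀ r < g, τ.MS i (2 * g + 2 + (2 * r + 1)) = (τ.task i).CLlo (r + 1) := by
    intro r hr
    rw [τ.MS_of_odd i (by rw [hmod _ (by omega)]; omega) (by omega), hmod _ (by omega)]
    congr 1
    omega
  have hC : ∀ r ∈ Finset.range (2 * g + 2),
      (τ.task i).MLup (r % (2 * g + 2)) = (τ.task i).MLup r :=
    fun r hr => by rw [Nat.mod_eq_of_lt (Finset.mem_range.1 hr)]
  have hS : ∑ r ∈ Finset.range (2 * g), τ.MS i (2 * g + 2 + r)
      = ∑ r ∈ Finset.range g, τ.GRlo i r + ∑ r ∈ Finset.range g, (τ.task i).CLlo (r + 1) := by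
    rw [sum_range_two_mul, ← Finset.sum_add_distrib]
    refine Finset.sum_congr rfl fun r hr => ?_
    have := Finset.mem_range.1 hr
    rw [hE r this.le, hO r this]
  rw [hM, Finset.sum_add_distrib, Finset.sum_congr rfl hC,
    Finset.sum_range_succ (fun r => τ.MS i (2 * g + 2 + r)),
    Finset.sum_range_succ (fun r => τ.MS i (2 * g + 2 + r)), hS, hE g le_rfl, hlast,
    Finset.sum_range_succ (fun r => τ.GRlo i r)]
  ring

end TaskSystem

lemma toReal_add_le {x y : EReal} {c : ℝ} (hx : (x.toReal : EReal) = x)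
    (hy : (y.toReal : EReal) = y) (h : x + (c : EReal) ≤ y) : x.toReal + c ≤ y.toReal := by
  rw [← hx, ← hy] at h
  exact_mod_cast h

lemma toReal_le_of_le {x y : EReal} (hx : (x.toReal : EReal) = x)
    (hy : (y.toReal : EReal) = y) (h : x ≤ y) : x.toReal ≤ y.toReal := by
  rw [← hx, ← hy] at h
  exact_mod_cast h

/-! ### CPU and bus use of a task that meets its deadlines -/

namespace Run

variable {n : ℕ} {τ : TaskSystem n} {σ : Run n} {i : Fin n}

/-- The times at which the bus serves task `i`. -/
def busTimes (τ : TaskSystem n) (σ : Run n) (i : Fin n) : Set ℝ :=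
  {u : ℝ | ∃ a j : ℕ, σ.IsCopy τ i a j ∧ σ.copyStart i a j ≤ (u : EReal) ∧
    (u : EReal) < σ.finish i a (2 * j + 1)}

namespace Legal

variable (hσ : σ.Legal τ)
include hσ

lemma cpuService_lt {a j : ℕ} (ha : (a : ℕ∞) < σ.numJobs i) (hj : j < (τ.task i).m) {A t : ℝ}
    (hA : σ.avail τ i a (4 * j) = A) (hAt : A ≤ t) (ht : (t : EReal) < σ.finish i a (4 * j)) :
    volume.real ({u | σ.CpuRuns τ i u} ∩ Set.Ico A t) < (τ.task i).CLup j := by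
  rw [← cpuService_coe]
  refine lt_of_lt_of_le ?_ (hσ.cpuExec_mem i a j ha hj).2
  by_contra hcon
  refine ht.not_ge ?_
  rw [hσ.cpu_finish i a j ha hj]
  exact sInf_le ⟨t, by rw [hA]; exact EReal.coe_le_coe_iff.2 hAt, by rw [hA]; exact not_lt.1 hcon,
    rfl⟩

/-- Before the finish the service is below the execution time by the infimum definition. The bound
passes to the finish itself because the last `ε` time units add at most `ε` service. -/
lemma cpu_use_le {a j : ℕ} (ha : (a : ℕ∞) < σ.numJobs i) (hj : j < (τ.task i).m) {A F : ℝ}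
    (hA : σ.avail τ i a (4 * j) = A) (hF : σ.finish i a (4 * j) = F) :
    volume.real ({u | σ.CpuRuns τ i u} ∩ Set.Ico A F) ≤ (τ.task i).CLup j := by
  have hC : 0 ≤ (τ.task i).CLup j :=
    ((τ.task i).CL_bounds j hj).1.trans ((τ.task i).CL_bounds j hj).2
  refine le_of_forall_pos_le_add fun ε hε => ?_
  rcases le_or_gt F A with h | h
  · simp only [Set.Ico_eq_empty_of_le h, Set.inter_empty, measureReal_empty]
    linarith
  · have h1 : max A (F - ε) < F := max_lt h (by linarith)
    have h2 := hσ.cpuService_lt ha hj hA (le_max_left A (F - ε))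
      (by rw [hF]; exact EReal.coe_lt_coe_iff.2 h1)
    have h3 := volume_real_Ico_inter_le_add (U := {u | σ.CpuRuns τ i u}) (s := A)
      (x := max A (F - ε)) (y := F)
    have h4 := volume_real_inter_Ico_le (U := {u | σ.CpuRuns τ i u}) h1.le
    have h5 := le_max_right A (F - ε)
    linarith

lemma cpu_gap {a r : ℕ} (ha : (a : ℕ∞) < σ.numJobs i) (hr : r + 1 < (τ.task i).m) :
    σ.finish i a (4 * r)
        + (((τ.task i).MLlo (2 * r) + τ.GRlo i r + (τ.task i).MLlo (2 * r + 1) : ℝ) : EReal)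
      ≤ σ.avail τ i a (4 * (r + 1)) := by
  have c1 : σ.IsCopy τ i a (2 * r) := ⟨ha, by omega⟩
  have c2 : σ.IsCopy τ i a (2 * r + 1) := ⟨ha, by omega⟩
  have h1 := (add_le_add_left (hσ.copy_avail i a _ c1) _).trans (hσ.copyStart_add_MLlo_le c1)
  have h2 := hσ.avail_add_GRlo_le (j := r) ha (by omega)
  have h3 := (add_le_add_left (hσ.copy_avail i a _ c2) _).trans (hσ.copyStart_add_MLlo_le c2)
  rw [show 2 * (2 * r) + 1 = 4 * r + 1 by ring, avail_succ] at h1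
  rw [avail_succ] at h2
  rw [show 2 * (2 * r + 1) + 1 = 4 * r + 3 by ring, avail_succ] at h3
  rw [show 4 * (r + 1) = 4 * r + 3 + 1 by ring, avail_succ, EReal.coe_add, EReal.coe_add,
    ← add_assoc, ← add_assoc]
  exact (add_le_add_left ((add_le_add_left h1 _).trans h2) _).trans h3

lemma copy_gap_even {a g : ℕ} (ha : (a : ℕ∞) < σ.numJobs i) (hg : g + 1 < (τ.task i).m) :
    σ.finish i a (2 * (2 * g) + 1) + (τ.GRlo i g : EReal) ≤ σ.copyStart i a (2 * g + 1) := by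
  have h2 := hσ.avail_add_GRlo_le (j := g) ha (by omega)
  rw [avail_succ] at h2
  rw [show 2 * (2 * g) + 1 = 4 * g + 1 by ring]
  refine h2.trans (le_trans (le_of_eq ?_) (hσ.copy_avail i a (2 * g + 1) ⟨ha, by omega⟩))
  rw [avail_succ]
  congr 1
  omega

lemma copy_gap_odd {a g : ℕ} (ha : (a : ℕ∞) < σ.numJobs i) (hg : g + 2 < (τ.task i).m) :
    σ.finish i a (2 * (2 * g + 1) + 1) + ((τ.task i).CLlo (g + 1) : EReal)
      ≤ σ.copyStart i a (2 * g + 2) := by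
  have h2 := hσ.avail_add_CLlo_le (j := g + 1) ha (by omega)
  rw [show 4 * (g + 1) = 2 * (2 * g + 1) + 1 + 1 by ring, avail_succ] at h2
  refine h2.trans (le_trans (le_of_eq ?_) (hσ.copy_avail i a (2 * g + 2) ⟨ha, by omega⟩))
  rw [avail_succ]
  congr 1

section Deadlines

variable (hd : σ.MeetsDeadlines τ i)
include hd

/-- A CPU segment occupies the interval from availability to finish, preemptions included; its use
of the CPU there, not the length of the interval, is bounded by `CLup`. -/
lemma cpu_pattern :
    SegmentPattern (τ.task i).m (fun q => (τ.task i).CLup (q % (τ.task i).m)) (τ.CS i)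
      (τ.task i).T (fun q => ((q / (τ.task i).m : ℕ) : ℕ∞) < σ.numJobs i)
      (fun q => (σ.avail τ i (q / (τ.task i).m) (4 * (q % (τ.task i).m))).toReal)
      (fun q => (σ.finish i (q / (τ.task i).m) (4 * (q % (τ.task i).m))).toReal)
      {u | σ.CpuRuns τ i u} := by
  have hm := (τ.task i).m_pos
  have hlt : ∀ q, q % (τ.task i).m < (τ.task i).m := fun q => Nat.mod_lt _ hm
  have hpos : ∀ q, 4 * (q % (τ.task i).m) ≤ 4 * ((τ.task i).m - 1) := fun q => by
    have := hlt q; omega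
  have hvalid : ∀ q, (((q + 1) / (τ.task i).m : ℕ) : ℕ∞) < σ.numJobs i →
      ((q / (τ.task i).m : ℕ) : ℕ∞) < σ.numJobs i := fun q hq =>
    lt_of_le_of_lt (by exact_mod_cast Nat.div_le_div_right (Nat.le_succ q)) hq
  have hfar : ∀ a p : ℕ, (((a + p + 1) * (τ.task i).m / (τ.task i).m : ℕ) : ℕ∞) < σ.numJobs i →
      (σ.finish i ((a * (τ.task i).m + ((τ.task i).m - 1)) / (τ.task i).m)
        (4 * ((a * (τ.task i).m + ((τ.task i).m - 1)) % (τ.task i).m))).toReal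
        + ((τ.task i).T - (τ.task i).D + p * (τ.task i).T)
      ≤ (σ.avail τ i ((a + p + 1) * (τ.task i).m / (τ.task i).m)
        (4 * ((a + p + 1) * (τ.task i).m % (τ.task i).m))).toReal := by
    intro a p hv
    have hdm : (a * (τ.task i).m + ((τ.task i).m - 1)) / (τ.task i).m = a ∧
        (a * (τ.task i).m + ((τ.task i).m - 1)) % (τ.task i).m = (τ.task i).m - 1 :=
      (Nat.div_mod_unique hm).2 ⟨by ring, by omega⟩
    rw [Nat.mul_div_cancel _ hm] at hv ⊢
    rw [Nat.mul_mod_left, hdm.1, hdm.2]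
    have ha : (a : ℕ∞) < σ.numJobs i :=
      lt_of_le_of_lt (by exact_mod_cast (by omega : a ≤ a + p + 1)) hv
    exact toReal_add_le (hσ.finish_coe hd ha le_rfl) (hσ.avail_coe hd hv (by omega))
      ((hσ.jobFinish_le_release hd p hv).trans (hσ.release_le_avail hv (by omega)))
  have hgap : ∀ q, q % (τ.task i).m ≠ (τ.task i).m - 1 →
      (((q + 1) / (τ.task i).m : ℕ) : ℕ∞) < σ.numJobs i →
      (σ.finish i (q / (τ.task i).m) (4 * (q % (τ.task i).m))).toReal
        + ((τ.task i).MLlo (2 * (q % (τ.task i).m)) + τ.GRlo i (q % (τ.task i).m)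
          + (τ.task i).MLlo (2 * (q % (τ.task i).m) + 1))
      ≤ (σ.avail τ i ((q + 1) / (τ.task i).m) (4 * ((q + 1) % (τ.task i).m))).toReal := by
    intro q hq hv
    have hv' := hvalid q hv
    have hl := hlt q
    obtain ⟨e1, e2⟩ := succ_div_mod_of_ne hm hq
    rw [e1, e2]
    exact toReal_add_le (hσ.finish_coe hd hv' (hpos q)) (hσ.avail_coe hd hv' (by omega))
      (hσ.cpu_gap hv' (by omega))
  refine ⟨hm, (τ.task i).T_pos, ?_, ?_, fun q hq => τ.CS_add_m i hq, τ.sum_CS_period i, hvalid,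
    ?_, ?_, ?_, ?_, ?_, ?_⟩
  · intro q
    have := (τ.task i).CL_bounds _ (hlt q)
    exact this.1.trans this.2
  · intro q
    simp only [Nat.add_mod_right]
  · intro q hv
    exact toReal_le_of_le (hσ.avail_coe hd hv (hpos q)) (hσ.finish_coe hd hv (hpos q))
      (hσ.avail_le_finish hv (hpos q))
  · intro q hv
    by_cases hq : q % (τ.task i).m = (τ.task i).m - 1
    · have hq' : q = q / (τ.task i).m * (τ.task i).m + ((τ.task i).m - 1) := by
        rw [← hq, mul_comm]; exact (Nat.div_add_mod _ _).symm
      have e : q + 1 = (q / (τ.task i).m + 0 + 1) * (τ.task i).m := by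
        rw [add_zero, add_mul, one_mul]; omega
      have h1 := hfar (q / (τ.task i).m) 0 (by rw [← e]; exact hv)
      rw [← e, ← hq'] at h1
      have h2 := (τ.task i).D_le_T
      simp only [Nat.cast_zero, zero_mul, add_zero] at h1
      linarith
    · have h1 := hgap q hq hv
      have hl := hlt q
      have h2 := ((τ.task i).ML_bounds (2 * (q % (τ.task i).m)) (by omega)).1
      have h3 := ((τ.task i).ML_bounds (2 * (q % (τ.task i).m) + 1) (by omega)).1
      have h4 := τ.GRlo_nonneg i (j := q % (τ.task i).m) (by omega)
      linarith
  · intro q q' hqq hq hv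
    rw [τ.CS_of_ne i (by rwa [← hqq]), ← hqq]
    exact hgap q hq hv
  · intro a p hv
    rw [τ.CS_first, add_assoc]
    exact hfar a p hv
  · rintro u ⟨⟨a, j, ha, hj, h1, h2⟩, -⟩
    obtain ⟨e1, e2⟩ : (a * (τ.task i).m + j) / (τ.task i).m = a ∧
        (a * (τ.task i).m + j) % (τ.task i).m = j :=
      (Nat.div_mod_unique hm).2 ⟨by ring, hj⟩
    refine ⟨a * (τ.task i).m + j, ?_⟩
    simp only [e1, e2]
    rw [← hσ.avail_coe hd ha (by omega), EReal.coe_le_coe_iff] at h1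
    rw [← hσ.finish_coe hd ha (by omega), EReal.coe_lt_coe_iff] at h2
    exact ⟨ha, h1, h2⟩
  · intro q hv
    exact hσ.cpu_use_le hv (hlt q) (hσ.avail_coe hd hv (hpos q)).symm
      (hσ.finish_coe hd hv (hpos q)).symm

/-- The CPU time of a task that meets its deadlines in a window is bounded by its workload
function. -/
lemma cpu_demand_le (s : ℝ) {t : ℝ} (ht : 0 ≤ t) :
    volume.real ({u | σ.CpuRuns τ i u} ∩ Set.Ico s (s + t))
      ≤ ⨆ h : Fin (τ.task i).m, τ.CW i h t := by
  obtain ⟨h, hh, hle⟩ := (hσ.cpu_pattern hd).exists_use_le_workload s ht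
  exact hle.trans (le_ciSup (f := fun h : Fin (τ.task i).m => τ.CW i h t)
    (Set.finite_range _).bddAbove ⟨h, hh⟩)

/-- Copies are not preempted, so the interval begins at `copyStart` and its whole length is bounded
by `MLup`. Between the last copy of one job and the first copy of a later one lie a final and an
initial CPU segment, which yield the two extra `CLlo` terms. -/
lemma bus_pattern (hm : 2 ≤ (τ.task i).m) :
    SegmentPattern (2 * (τ.task i).m - 2)
      (fun q => (τ.task i).MLup (q % (2 * (τ.task i).m - 2))) (τ.MS i) (τ.task i).T
      (fun q => ((q / (2 * (τ.task i).m - 2) : ℕ) : ℕ∞) < σ.numJobs i)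
      (fun q => (σ.copyStart i (q / (2 * (τ.task i).m - 2))
        (q % (2 * (τ.task i).m - 2))).toReal)
      (fun q => (σ.finish i (q / (2 * (τ.task i).m - 2))
        (2 * (q % (2 * (τ.task i).m - 2)) + 1)).toReal)
      (σ.busTimes τ i) := by
  obtain ⟨M, hM⟩ : ∃ M, M = 2 * (τ.task i).m - 2 := ⟨_, rfl⟩
  have hM0 : 0 < M := by omega
  have hM1 : 2 * (τ.task i).m - 3 = M - 1 := by omega
  have hsum := τ.sum_MS_period i hm
  have hper : ∀ q, M ≤ q → τ.MS i (q + M) = τ.MS i q := by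
    rw [hM]; exact fun q hq => τ.MS_add i hm hq
  rw [← hM] at hsum ⊢
  have hlt : ∀ q, q % M < 2 * (τ.task i).m - 2 := fun q => hM ▸ Nat.mod_lt _ hM0
  have hpos : ∀ q, 2 * (q % M) + 1 ≤ 4 * ((τ.task i).m - 1) := fun q => by
    have := hlt q; omega
  have hvalid : ∀ q, (((q + 1) / M : ℕ) : ℕ∞) < σ.numJobs i →
      ((q / M : ℕ) : ℕ∞) < σ.numJobs i := fun q hq =>
    lt_of_le_of_lt (by exact_mod_cast Nat.div_le_div_right (Nat.le_succ q)) hq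
  have hfar : ∀ a p : ℕ, (((a + p + 1) * M / M : ℕ) : ℕ∞) < σ.numJobs i →
      (σ.finish i ((a * M + (M - 1)) / M) (2 * ((a * M + (M - 1)) % M) + 1)).toReal
        + ((τ.task i).CLlo ((τ.task i).m - 1) +
          ((τ.task i).T - (τ.task i).D + p * (τ.task i).T) + (τ.task i).CLlo 0)
      ≤ (σ.copyStart i ((a + p + 1) * M / M) ((a + p + 1) * M % M)).toReal := by
    intro a p hv
    obtain ⟨e1, e2⟩ : (a * M + (M - 1)) / M = a ∧ (a * M + (M - 1)) % M = M - 1 :=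
      (Nat.div_mod_unique hM0).2 ⟨by ring, by omega⟩
    rw [Nat.mul_div_cancel _ hM0] at hv ⊢
    rw [Nat.mul_mod_left, e1, e2]
    have ha : (a : ℕ∞) < σ.numJobs i :=
      lt_of_le_of_lt (by exact_mod_cast (by omega : a ≤ a + p + 1)) hv
    have c : σ.IsCopy τ i (a + p + 1) 0 := ⟨hv, by omega⟩
    refine toReal_add_le (hσ.finish_coe hd ha (by omega)) (hσ.copyStart_coe hd c) ?_
    have h1 := hσ.avail_add_CLlo_le (j := (τ.task i).m - 1) ha (by omega)
    rw [show 4 * ((τ.task i).m - 1) = 2 * (M - 1) + 1 + 1 by omega, avail_succ] at h1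
    have h2 := (hσ.jobFinish_le_release hd p hv).trans
      (hσ.release_le_avail (p := 4 * 0) hv (by omega))
    rw [jobFinish, show 4 * ((τ.task i).m - 1) = 2 * (M - 1) + 1 + 1 by omega] at h2
    have h3 := (hσ.avail_add_CLlo_le (j := 0) hv (by omega)).trans
      (((avail_succ _ _).symm.le).trans (hσ.copy_avail i _ 0 c))
    rw [EReal.coe_add, EReal.coe_add, ← add_assoc, ← add_assoc]
    exact (add_le_add_left ((add_le_add_left h1 _).trans h2) _).trans h3
  have hgap : ∀ q q', q % M = q' % M → q % M ≠ M - 1 →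
      (((q + 1) / M : ℕ) : ℕ∞) < σ.numJobs i →
      (σ.finish i (q / M) (2 * (q % M) + 1)).toReal + τ.MS i q'
        ≤ (σ.copyStart i ((q + 1) / M) ((q + 1) % M)).toReal ∧ 0 ≤ τ.MS i q' := by
    intro q q' hqq hq hv
    have hv' := hvalid q hv
    have hl := hlt q
    obtain ⟨e1, e2⟩ := succ_div_mod_of_ne hM0 hq
    have hpar : q' % M % 2 = q' % 2 := by rw [hM]; exact mod_copies_mod_two _ _
    rw [e1, e2]
    have key : ∀ c : ℝ, σ.finish i (q / M) (2 * (q % M) + 1) + (c : EReal)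
        ≤ σ.copyStart i (q / M) (q % M + 1) →
        (σ.finish i (q / M) (2 * (q % M) + 1)).toReal + c
          ≤ (σ.copyStart i (q / M) (q % M + 1)).toReal := fun c hc =>
      toReal_add_le (hσ.finish_coe hd hv' (hpos q)) (hσ.copyStart_coe hd ⟨hv', by omega⟩) hc
    rcases Nat.mod_two_eq_zero_or_one q' with h2 | h2
    · obtain ⟨g, hg⟩ : ∃ g, q % M = 2 * g := ⟨q % M / 2, by omega⟩
      have e : τ.MS i q' = τ.GRlo i g := by
        rw [τ.MS_of_even i (by rw [← hM, hM1, ← hqq]; exact hq) h2, ← hM, ← hqq, hg]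
        congr 1
        omega
      rw [e]
      refine ⟨key _ ?_, τ.GRlo_nonneg i (by omega)⟩
      rw [hg]
      exact hσ.copy_gap_even hv' (by omega)
    · obtain ⟨g, hg⟩ : ∃ g, q % M = 2 * g + 1 := ⟨q % M / 2, by omega⟩
      have e : τ.MS i q' = (τ.task i).CLlo (g + 1) := by
        rw [τ.MS_of_odd i (by rw [← hM, hM1, ← hqq]; exact hq) h2, ← hM, ← hqq, hg]
        congr 1
        omega
      rw [e]
      refine ⟨key _ ?_, ((τ.task i).CL_bounds _ (by omega)).1⟩
      rw [hg]
      exact hσ.copy_gap_odd hv' (by omega)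
  refine ⟨hM0, (τ.task i).T_pos, ?_, ?_, hper, hsum, hvalid, ?_, ?_, ?_, ?_, ?_, ?_⟩
  · intro q
    exact ((τ.task i).ML_bounds _ (hlt q)).2.2.le
  · intro q
    simp only [Nat.add_mod_right]
  · intro q hv
    exact toReal_le_of_le (hσ.copyStart_coe hd ⟨hv, hlt q⟩) (hσ.finish_coe hd hv (hpos q))
      (hσ.copyStart_le_finish ⟨hv, hlt q⟩)
  · intro q hv
    by_cases hq : q % M = M - 1
    · have hq' : q = q / M * M + (M - 1) := by
        rw [← hq, mul_comm]; exact (Nat.div_add_mod _ _).symm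
      have e : q + 1 = (q / M + 0 + 1) * M := by
        rw [add_zero, add_mul, one_mul]; omega
      have h1 := hfar (q / M) 0 (by rw [← e]; exact hv)
      rw [← e, ← hq'] at h1
      have h2 := (τ.task i).D_le_T
      have h3 := ((τ.task i).CL_bounds ((τ.task i).m - 1) (by omega)).1
      have h4 := ((τ.task i).CL_bounds 0 (by omega)).1
      simp only [Nat.cast_zero, zero_mul, add_zero] at h1
      linarith
    · have h1 := hgap q q rfl hq hv
      linarith [h1.1, h1.2]
  · intro q q' hqq hq hv
    exact (hgap q q' hqq hq hv).1
  · intro a p hv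
    have h1 := hfar a p hv
    have h2 := τ.MS_first i hm
    rw [hM1] at h2
    rw [h2]
    linarith
  · rintro u ⟨a, j, hc, h1, h2⟩
    have hj : j < M := hM ▸ hc.2
    obtain ⟨e1, e2⟩ : (a * M + j) / M = a ∧ (a * M + j) % M = j :=
      (Nat.div_mod_unique hM0).2 ⟨by ring, hj⟩
    refine ⟨a * M + j, ?_⟩
    simp only [e1, e2]
    rw [← hσ.copyStart_coe hd hc, EReal.coe_le_coe_iff] at h1
    rw [← hσ.finish_coe hd hc.1 (by omega), EReal.coe_lt_coe_iff] at h2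
    exact ⟨hc.1, h1, h2⟩
  · intro q hv
    have c : σ.IsCopy τ i (q / M) (q % M) := ⟨hv, hlt q⟩
    have h1 := hσ.finish_le_copyStart_add_MLup c
    have h2 := hσ.copyStart_le_finish c
    rw [← hσ.copyStart_coe hd c, ← hσ.finish_coe hd hv (hpos q)] at h1 h2
    have h3 := volume_real_inter_Ico_le (U := σ.busTimes τ i) (EReal.coe_le_coe_iff.1 h2)
    rw [← EReal.coe_add, EReal.coe_le_coe_iff] at h1
    linarith

/-- The bus time of a task that meets its deadlines in a window is bounded by its workload
function. -/
lemma bus_demand_le (s : ℝ) {t : ℝ} (ht : 0 ≤ t) :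
    volume.real (σ.busTimes τ i ∩ Set.Ico s (s + t))
      ≤ ⨆ h : Fin (2 * (τ.task i).m - 2), τ.MW i h t := by
  -- For `m = 1` there are no copies and the index type is empty, so the use and the supremum are
  -- both `0`.
  rcases Nat.lt_or_ge (τ.task i).m 2 with hm | hm
  · have he : σ.busTimes τ i = ∅ := by
      refine Set.eq_empty_of_forall_notMem ?_
      rintro u ⟨a, j, hc, -⟩
      have := hc.2
      omega
    have : IsEmpty (Fin (2 * (τ.task i).m - 2)) := by
      rw [show 2 * (τ.task i).m - 2 = 0 by omega]
      infer_instance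
    simp [he]
  · obtain ⟨h, hh, hle⟩ := (hσ.bus_pattern hd hm).exists_use_le_workload s ht
    exact hle.trans (le_ciSup (f := fun h : Fin (2 * (τ.task i).m - 2) => τ.MW i h t)
      (Set.finite_range _).bddAbove ⟨h, hh⟩)

end Deadlines

end Legal

end Run

/-! ### Least solutions, blocking, and sums over positions -/

namespace TaskSystem

variable {n : ℕ} (τ : TaskSystem n)

/-- A bound proved for every solution passes to the infimum, attained or not; without solutions the
right-hand side is `⊤`. -/
lemma le_add_leastSolution {F : ℝ → EReal} {A : ℝ} {f : EReal}
    (h : ∀ x : ℝ, 0 ≤ x → (x : EReal) = F x → f ≤ ((A + x : ℝ) : EReal)) :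
    f ≤ (A : EReal) + leastSolution F := by
  rw [add_comm, ← EReal.sub_le_iff_le_add (Or.inl (EReal.coe_ne_bot _))
    (Or.inl (EReal.coe_ne_top _))]
  refine le_sInf ?_
  rintro _ ⟨x, hx, hF, rfl⟩
  rw [EReal.sub_le_iff_le_add (Or.inl (EReal.coe_ne_bot _)) (Or.inl (EReal.coe_ne_top _)),
    ← EReal.coe_add, add_comm x A]
  exact h x hx hF

lemma leastSolution_nonneg (F : ℝ → EReal) : 0 ≤ leastSolution F := by
  refine le_sInf ?_
  rintro _ ⟨x, hx, -, rfl⟩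
  exact EReal.coe_nonneg.2 hx

lemma blocking_nonneg (k : Fin n) : 0 ≤ τ.blocking k :=
  Real.iSup_nonneg fun i => Real.iSup_nonneg fun h =>
    ((τ.task i).ML_bounds h h.2).2.2.le

lemma MLup_le_blocking {k i : Fin n} (hi : τ.prio i < τ.prio k) {j : ℕ}
    (hj : j < 2 * (τ.task i).m - 2) : (τ.task i).MLup j ≤ τ.blocking k := by
  refine le_trans ?_ (le_ciSup (f := fun i : {i : Fin n // τ.prio i < τ.prio k} =>
    ⨆ h : Fin (2 * (τ.task i).m - 2), (τ.task i).MLup h) (Set.finite_range _).bddAbove ⟨i, hi⟩)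
  exact le_ciSup (f := fun h : Fin (2 * (τ.task i).m - 2) => (τ.task i).MLup h)
    (Set.finite_range _).bddAbove ⟨j, hj⟩

lemma mem_hp {k i : Fin n} : i ∈ τ.hp k ↔ τ.prio k < τ.prio i := by
  simp [hp]

lemma GRup_nonneg {i : Fin n} {j : ℕ} (hj : j < (τ.task i).m - 1) : 0 ≤ τ.GRup i j := by
  have hW := (τ.task i).GW_bounds j hj
  have hL := (τ.task i).GL_bounds j hj
  have hα := (τ.task i).α_bounds j hj
  exact (τ.GRlo_nonneg i hj).trans ((τ.GRlo_le_gpuTime i hj le_rfl le_rfl le_rfl).trans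
    (τ.gpuTime_le_GRup i hj le_rfl hW.2 hL le_rfl hα))

/-- A quantity attached to the segment at position `p` of a job, given by its values on the CPU,
memory-copy and GPU segments. -/
def atPosition {β : Type*} (c d g : ℕ → β) (p : ℕ) : β :=
  if p % 4 = 0 then c (p / 4) else if p % 4 = 2 then g (p / 4) else d (p / 2)

section

variable {β : Type*} (c d g : ℕ → β)

lemma atPosition_cpu (j : ℕ) : atPosition c d g (4 * j) = c j := by
  simp [atPosition]

lemma atPosition_gpu (j : ℕ) : atPosition c d g (4 * j + 2) = g j := by
  unfold atPosition
  rw [if_neg (by omega), if_pos (by omega)]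
  congr 1
  omega

lemma atPosition_copy (j : ℕ) : atPosition c d g (2 * j + 1) = d j := by
  unfold atPosition
  rw [if_neg (by omega), if_neg (by omega)]
  congr 1
  omega

lemma sum_atPosition [AddCommMonoid β] (j : ℕ) :
    ∑ p ∈ Finset.range (4 * j + 1), atPosition c d g p
      = ∑ q ∈ Finset.range j, g q + ∑ q ∈ Finset.range (2 * j), d q
        + ∑ q ∈ Finset.range (j + 1), c q := by
  induction j with
  | zero => simp [atPosition]
  | succ j ih =>
    have h1 : atPosition c d g (4 * j + 1) = d (2 * j) := by
      rw [← atPosition_copy c d g]; congr 1; omega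
    have h3 : atPosition c d g (4 * j + 3) = d (2 * j + 1) := by
      rw [← atPosition_copy c d g]; congr 1; omega
    have h4 : atPosition c d g (4 * j + 4) = c (j + 1) := by
      rw [← atPosition_cpu c d g]; congr 1
    rw [show 4 * (j + 1) + 1 = 4 * j + 1 + 1 + 1 + 1 + 1 by ring, Finset.sum_range_succ,
      Finset.sum_range_succ, Finset.sum_range_succ, Finset.sum_range_succ, ih, h1,
      show 4 * j + 1 + 1 = 4 * j + 2 by ring, atPosition_gpu, show 4 * j + 2 + 1 = 4 * j + 3 by ring,
      h3, show 4 * j + 3 + 1 = 4 * j + 4 by ring, h4, Finset.sum_range_succ g,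
      show 2 * (j + 1) = 2 * j + 1 + 1 by ring, Finset.sum_range_succ d, Finset.sum_range_succ d,
      Finset.sum_range_succ c (j + 1)]
    abel

end

end TaskSystem

/-! ### Delays of the segments of one task -/

namespace Run

variable {n : ℕ} {τ : TaskSystem n} {σ : Run n} {k : Fin n}

/-- The times at which the CPU executes a task with higher priority than `k`. -/
def hpTimes (τ : TaskSystem n) (σ : Run n) (k : Fin n) : Set ℝ :=
  {u : ℝ | ∃ i ∈ τ.hp k, σ.CpuRuns τ i u}

lemma measurableSet_cpuPending (i : Fin n) : MeasurableSet {u : ℝ | σ.CpuPending τ i u} := by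
  have h : {u : ℝ | σ.CpuPending τ i u} = ⋃ (a : ℕ) (j : ℕ),
      {u : ℝ | ((a : ℕ∞) < σ.numJobs i ∧ j < (τ.task i).m) ∧
        (σ.avail τ i a (4 * j) ≤ (u : EReal) ∧ (u : EReal) < σ.finish i a (4 * j))} := by
    ext u
    simp only [CpuPending, Set.mem_ofPred_eq, Set.mem_iUnion, and_assoc]
  rw [h]
  refine MeasurableSet.iUnion fun a => MeasurableSet.iUnion fun j => ?_
  refine MeasurableSet.inter (MeasurableSet.const _) (MeasurableSet.inter ?_ ?_)
  · exact measurableSet_le measurable_const measurable_coe_real_ereal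
  · exact measurableSet_lt measurable_coe_real_ereal measurable_const

lemma measurableSet_cpuRuns (i : Fin n) : MeasurableSet {u : ℝ | σ.CpuRuns τ i u} := by
  have h : {u : ℝ | σ.CpuRuns τ i u} = {u : ℝ | σ.CpuPending τ i u} ∩
      ⋂ i' ∈ τ.hp i, {u : ℝ | σ.CpuPending τ i' u}ᶜ := by
    ext u
    simp [CpuRuns]
  rw [h]
  exact (measurableSet_cpuPending i).inter
    (Finset.measurableSet_biInter _ fun i' _ => (measurableSet_cpuPending i').compl)

lemma hpTimes_eq : σ.hpTimes τ k = ⋃ i ∈ τ.hp k, {u : ℝ | σ.CpuRuns τ i u} := by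
  ext u
  simp [hpTimes]

lemma measurableSet_hpTimes : MeasurableSet (σ.hpTimes τ k) := by
  rw [hpTimes_eq]
  exact Finset.measurableSet_biUnion _ fun i _ => measurableSet_cpuRuns i

/-- Concatenating the interference of successive segments in the bound `R2` needs the sum over
adjacent intervals to be at most the total. Subadditivity goes the wrong way, hence the
measurability proofs. -/
lemma volume_hpTimes_add {r s t : ℝ} (h1 : r ≤ s) (h2 : s ≤ t) :
    volume.real (σ.hpTimes τ k ∩ Set.Ico r s) + volume.real (σ.hpTimes τ k ∩ Set.Ico s t)
      = volume.real (σ.hpTimes τ k ∩ Set.Ico r t) := by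
  have hfin : ∀ x y : ℝ, volume (σ.hpTimes τ k ∩ Set.Ico x y) ≠ ⊤ := fun x y =>
    ((measure_mono Set.inter_subset_right).trans_lt (by simp)).ne
  rw [← Set.Ico_union_Ico_eq_Ico h1 h2, Set.inter_union_distrib_left,
    measureReal_union _ (measurableSet_hpTimes.inter measurableSet_Ico) (hfin r s) (hfin s t)]
  refine Set.disjoint_left.2 ?_
  rintro u ⟨-, -, h3⟩ ⟨-, h4, -⟩
  exact absurd h4 (not_le.2 h3)

lemma volume_hpTimes_mono {r s t : ℝ} (h : s ≤ t) :
    volume.real (σ.hpTimes τ k ∩ Set.Ico r s) ≤ volume.real (σ.hpTimes τ k ∩ Set.Ico r t) :=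
  volume_real_inter_Ico_mono (Set.inter_subset_inter_right _ (Set.Ico_subset_Ico_right h))

/-- The CPU does not idle while `k` is pending. -/
lemma cpuRuns_or_mem_hpTimes {u : ℝ} (h : σ.CpuPending τ k u) :
    σ.CpuRuns τ k u ∨ u ∈ σ.hpTimes τ k := by
  classical
  obtain ⟨i, hi, hmax⟩ := Finset.exists_max_image
    (Finset.univ.filter fun i => σ.CpuPending τ i u ∧ τ.prio k ≤ τ.prio i) τ.prio
    ⟨k, by simp [h]⟩
  simp only [Finset.mem_filter, Finset.mem_univ, true_and] at hi hmax
  have hrun : σ.CpuRuns τ i u := by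
    refine ⟨hi.1, fun i' hi' hp => ?_⟩
    have h1 := τ.mem_hp.1 hi'
    exact absurd (hmax i' ⟨hp, hi.2.trans h1.le⟩) (not_le.2 h1)
  rcases hi.2.eq_or_lt with heq | hlt
  · rw [τ.prio_injective heq]
    exact Or.inl hrun
  · exact Or.inr ⟨i, τ.mem_hp.2 hlt, hrun⟩

lemma elapsed_le_of_cpuPending {A y : ℝ} (hAy : A ≤ y)
    (h : ∀ u, A ≤ u → u < y → σ.CpuPending τ k u) :
    y - A ≤ volume.real ({u | σ.CpuRuns τ k u} ∩ Set.Ico A y)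
      + volume.real (σ.hpTimes τ k ∩ Set.Ico A y) := by
  rw [← Real.volume_real_Ico_of_le hAy]
  refine le_trans (measureReal_mono ?_ ?_) (measureReal_union_le _ _)
  · intro u hu
    rcases cpuRuns_or_mem_hpTimes (h u hu.1 hu.2) with h1 | h1
    · exact Or.inl ⟨h1, hu⟩
    · exact Or.inr ⟨h1, hu⟩
  · rw [← Set.union_inter_distrib_right]
    exact ((measure_mono Set.inter_subset_right).trans_lt (by simp)).ne

namespace Legal

variable (hσ : σ.Legal τ)
include hσ

/-- Until the segment finishes, the CPU serves `k` or a task of higher priority. The service of `k`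
is still strictly below its execution time, and this strictness drives the contradictions at
solutions. -/
lemma cpu_elapsed_lt {a j : ℕ} (ha : (a : ℕ∞) < σ.numJobs k) (hj : j < (τ.task k).m) {A t : ℝ}
    (hA : σ.avail τ k a (4 * j) = A) (hAt : A ≤ t) (ht : (t : EReal) < σ.finish k a (4 * j)) :
    t - A < (τ.task k).CLup j + volume.real (σ.hpTimes τ k ∩ Set.Ico A t) := by
  have h1 := hσ.cpuService_lt ha hj hA hAt ht
  have h2 := elapsed_le_of_cpuPending (σ := σ) (τ := τ) (k := k) hAt fun u hu hut =>
    ⟨a, j, ha, hj, by rw [hA]; exact EReal.coe_le_coe_iff.2 hu,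
      (EReal.coe_lt_coe_iff.2 hut).trans ht⟩
  linarith

lemma cpu_elapsed_le {a j : ℕ} (ha : (a : ℕ∞) < σ.numJobs k) (hj : j < (τ.task k).m) {A F : ℝ}
    (hA : σ.avail τ k a (4 * j) = A) (hAF : A ≤ F) (hF : σ.finish k a (4 * j) = F) :
    F - A ≤ (τ.task k).CLup j + volume.real (σ.hpTimes τ k ∩ Set.Ico A F) := by
  have h1 := hσ.cpu_use_le ha hj hA hF
  have h2 := elapsed_le_of_cpuPending (σ := σ) (τ := τ) (k := k) hAF fun u hu hut =>
    ⟨a, j, ha, hj, by rw [hA]; exact EReal.coe_le_coe_iff.2 hu,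
      by rw [hF]; exact EReal.coe_lt_coe_iff.2 hut⟩
  linarith

lemma jobFinish_le_avail {i : Fin n} {a a' p : ℕ} (haa : a' < a)
    (ha : (a : ℕ∞) < σ.numJobs i) (hp : p ≤ 4 * ((τ.task i).m - 1)) :
    σ.jobFinish τ i a' ≤ σ.avail τ i a p := by
  have hpos : ∀ b p : ℕ, (b : ℕ∞) < σ.numJobs i → p ≤ 4 * ((τ.task i).m - 1) →
      σ.avail τ i b 0 ≤ σ.avail τ i b p := by
    intro b p hb hp
    rcases Nat.eq_zero_or_pos p with rfl | h0
    · exact le_rfl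
    · exact (hσ.avail_le_finish hb (by omega)).trans (hσ.finish_le_avail hb h0 hp)
  refine le_trans ?_ (hpos a p ha hp)
  induction a, haa using Nat.le_induction with
  | base => exact le_max_right _ _
  | succ b _ ih =>
    have hb : (b : ℕ∞) < σ.numJobs i := lt_of_le_of_lt (by exact_mod_cast Nat.le_succ _) ha
    exact (ih hb).trans ((hpos b _ hb le_rfl).trans
      ((hσ.avail_le_finish hb le_rfl).trans (le_max_right _ _)))

/-- While a memory copy of `k` is waiting, the bus serves tasks with higher priority, or one
segment of lower priority. -/
lemma copy_wait_le {a j : ℕ} (hc : σ.IsCopy τ k a j) {A y : ℝ}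
    (hA : σ.avail τ k a (2 * j + 1) = A) (hAy : A ≤ y)
    (hy : (y : EReal) ≤ σ.copyStart k a j) :
    y - A ≤ τ.blocking k
      + ∑ i ∈ τ.hp k, volume.real (σ.busTimes τ i ∩ Set.Ico A y) := by
  classical
  -- Lower-priority blocking: such a copy must have started strictly before `A`, since from `A` on
  -- the waiting copy of `k` has precedence.
  set B : Set ℝ := {u : ℝ | ∃ (i' : Fin n) (a' j' : ℕ), τ.prio i' < τ.prio k ∧
    σ.IsCopy τ i' a' j' ∧ σ.copyStart i' a' j' < (A : EReal) ∧
    (u : EReal) < σ.finish i' a' (2 * j' + 1)} with hB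
  have hfin : ∀ V : Set ℝ, volume (V ∩ Set.Ico A y) ≠ ⊤ := fun V =>
    ((measure_mono Set.inter_subset_right).trans_lt (by simp)).ne
  have hcover : Set.Ico A y ⊆
      (B ∩ Set.Ico A y) ∪ ⋃ i ∈ τ.hp k, (σ.busTimes τ i ∩ Set.Ico A y) := by
    intro u hu
    have huS : (u : EReal) < σ.copyStart k a j := (EReal.coe_lt_coe_iff.2 hu.2).trans_le hy
    obtain ⟨i', a', j', hc', h1, h2⟩ := hσ.copy_work_conserving k a j hc u
      (by rw [hA]; exact EReal.coe_le_coe_iff.2 hu.1) huS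
    have hAu : (A : EReal) ≤ u := EReal.coe_le_coe_iff.2 hu.1
    rcases lt_trichotomy (τ.prio i') (τ.prio k) with hlt | heq | hgt
    · refine Or.inl ⟨⟨i', a', j', hlt, hc', ?_, h2⟩, hu⟩
      by_contra hcon
      exact hσ.copy_priority i' a' j' k a j hc' hc (τ.mem_hp.2 hlt)
        ⟨by rw [hA]; exact not_lt.1 hcon, h1.trans_lt huS⟩
    -- Segments of one task are sequential: another copy of `k` is either finished by `A` or starts
    -- only after the waiting one finishes.
    · exfalso
      obtain rfl := τ.prio_injective heq
      have hpj : 2 * j + 1 ≤ 4 * ((τ.task i').m - 1) := by have := hc.2; omega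
      have hpj' : 2 * j' + 1 ≤ 4 * ((τ.task i').m - 1) := by have := hc'.2; omega
      have hbefore : ¬ σ.finish i' a' (2 * j' + 1) ≤ σ.avail τ i' a (2 * j + 1) := by
        rw [hA, not_le]
        exact hAu.trans_lt h2
      have hafter : ¬ σ.finish i' a (2 * j + 1) ≤ σ.copyStart i' a' j' := fun h =>
        absurd ((hσ.copyStart_le_finish hc).trans (h.trans h1)) (not_le.2 huS)
      rcases lt_trichotomy a' a with h | rfl | h
      · exact hbefore ((hσ.finish_mono hc'.1 hpj' le_rfl).trans (hσ.jobFinish_le_avail h hc.1 hpj))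
      · rcases lt_trichotomy j' j with h | rfl | h
        · exact hbefore (hσ.finish_le_avail hc.1 (by omega) hpj)
        · exact absurd h1 (not_le.2 huS)
        · exact hafter ((hσ.finish_le_avail hc.1 (by omega) hpj').trans
            (hσ.copy_avail i' a' j' hc'))
      · exact hafter ((hσ.finish_mono hc.1 hpj le_rfl).trans
          ((hσ.jobFinish_le_avail h hc'.1 hpj').trans (hσ.copy_avail i' a' j' hc')))
    · refine Or.inr ?_
      simp only [Set.mem_iUnion]
      exact ⟨i', τ.mem_hp.2 hgt, ⟨a', j', hc', h1, h2⟩, hu⟩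
  have hBle : volume.real (B ∩ Set.Ico A y) ≤ τ.blocking k := by
    by_cases hne : ∃ (i' : Fin n) (a' j' : ℕ), τ.prio i' < τ.prio k ∧
        σ.IsCopy τ i' a' j' ∧ σ.copyStart i' a' j' < (A : EReal) ∧
        (A : EReal) < σ.finish i' a' (2 * j' + 1)
    · obtain ⟨i₀, a₀, j₀, hp₀, hc₀, hs₀, hf₀⟩ := hne
      -- Two different copies in progress at `A` would violate exclusivity of the bus, so one copy
      -- accounts for all of `B`.
      have hsub : B ∩ Set.Ico A y ⊆ Set.Ico A (A + (τ.task i₀).MLup j₀) := by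
        rintro u ⟨⟨i', a', j', hp', hc', hs', hf'⟩, hu⟩
        have hAu : (A : EReal) ≤ u := EReal.coe_le_coe_iff.2 hu.1
        have heq : (i₀, a₀, j₀) = (i', a', j') := by
          by_contra hcon
          rcases hσ.copy_exclusive i₀ a₀ j₀ i' a' j' hc₀ hc' hcon with h | h
          · exact absurd (hf₀.trans_le h) (not_lt.2 hs'.le)
          · exact absurd (hAu.trans_lt (hf'.trans_le h)) (not_lt.2 hs₀.le)
        obtain ⟨rfl, rfl, rfl⟩ : i₀ = i' ∧ a₀ = a' ∧ j₀ = j' := by simpa using heq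
        refine ⟨hu.1, ?_⟩
        have h1 := hf'.trans_le ((hσ.finish_le_copyStart_add_MLup hc').trans
          (add_le_add_left hs'.le _))
        rw [← EReal.coe_add, EReal.coe_lt_coe_iff] at h1
        exact h1
      refine (measureReal_mono hsub (by simp)).trans ?_
      rw [Real.volume_real_Ico_of_le (by linarith [((τ.task i₀).ML_bounds j₀ hc₀.2).2.2])]
      have := τ.MLup_le_blocking hp₀ hc₀.2
      linarith
    · have he : B ∩ Set.Ico A y = ∅ := by
        refine Set.eq_empty_of_forall_notMem ?_
        rintro u ⟨⟨i', a', j', hp', hc', hs', hf'⟩, hu⟩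
        exact hne ⟨i', a', j', hp', hc', hs', (EReal.coe_le_coe_iff.2 hu.1).trans_lt hf'⟩
      rw [he, measureReal_empty]
      exact τ.blocking_nonneg k
  rw [← Real.volume_real_Ico_of_le hAy]
  refine (measureReal_mono hcover ?_).trans ((measureReal_union_le _ _).trans
    (add_le_add hBle (measureReal_biUnion_finset_le _ _)))
  refine ((measure_union_le _ _).trans_lt (ENNReal.add_lt_top.2 ⟨(hfin B).lt_top, ?_⟩)).ne
  exact (measure_biUnion_finset_le _ _).trans_lt (ENNReal.sum_lt_top.2 fun i _ => (hfin _).lt_top)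

/-! ### Response time bounds -/

section HigherPriorityDeadlines

variable (hdl : ∀ i ∈ τ.hp k, σ.MeetsDeadlines τ i)
include hdl

lemma hp_demand_le (s : ℝ) {t : ℝ} (ht : 0 ≤ t) :
    volume.real (σ.hpTimes τ k ∩ Set.Ico s (s + t)) ≤ τ.cpuInterference k t := by
  rw [hpTimes_eq, Set.iUnion₂_inter]
  exact (measureReal_biUnion_finset_le _ _).trans
    (Finset.sum_le_sum fun i hi => hσ.cpu_demand_le (hdl i hi) s ht)

/-- If the segment were unfinished at a solution `x`, the elapsed time `x` would be strictly below
`CLup` plus the interference over `x`, which equals `x`. -/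
lemma cpu_finish_le_CRup {a j : ℕ} (ha : (a : ℕ∞) < σ.numJobs k) (hj : j < (τ.task k).m) :
    σ.finish k a (4 * j) ≤ σ.avail τ k a (4 * j) + τ.CRup k j := by
  induction hA : σ.avail τ k a (4 * j) with
  | bot =>
    have := hσ.release_le_avail ha (p := 4 * j) (by omega)
    rw [hA] at this
    simp at this
  | top =>
    rw [EReal.top_add_of_ne_bot]
    · exact le_top
    · exact (EReal.bot_lt_zero.trans_le (leastSolution_nonneg _)).ne'
  | coe A =>
    refine le_add_leastSolution fun x hx hsol => ?_
    have hsol' := EReal.coe_eq_coe_iff.1 hsol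
    by_contra hcon
    have h1 := hσ.cpu_elapsed_lt ha hj hA (by linarith) (not_le.1 hcon)
    have h2 := hσ.hp_demand_le hdl A hx
    linarith

lemma copy_finish_le_MRup {a j : ℕ} (hc : σ.IsCopy τ k a j) :
    σ.finish k a (2 * j + 1) ≤ σ.avail τ k a (2 * j + 1) + τ.MRup k j := by
  induction hA : σ.avail τ k a (2 * j + 1) with
  | bot =>
    have := hσ.release_le_avail hc.1 (p := 2 * j + 1) (by have := hc.2; omega)
    rw [hA] at this
    simp at this
  | top =>
    rw [EReal.top_add_of_ne_bot]
    · exact le_top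
    · exact (EReal.bot_lt_zero.trans_le (leastSolution_nonneg _)).ne'
  | coe A =>
    refine le_add_leastSolution fun x hx hsol => ?_
    have hsol' := EReal.coe_eq_coe_iff.1 hsol
    have hML := ((τ.task k).ML_bounds j hc.2).2.2
    have hdem : ∑ i ∈ τ.hp k, volume.real (σ.busTimes τ i ∩ Set.Ico A (A + x))
        ≤ τ.copyInterference k x :=
      Finset.sum_le_sum fun i hi => hσ.bus_demand_le (hdl i hi) A hx
    rcases le_or_gt ((A + x : ℝ) : EReal) (σ.copyStart k a j) with h | h
    -- Waiting for the full `x` is impossible: blocking plus interference over `x` is `x - MLup`,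
    -- and `MLup > 0`.
    · have h1 := hσ.copy_wait_le hc hA (by linarith) h
      linarith
    · have hAS : (A : EReal) ≤ σ.copyStart k a j := hA ▸ hσ.copy_avail k a j hc
      obtain ⟨S, hS⟩ : ∃ S : ℝ, σ.copyStart k a j = S :=
        ⟨_, (EReal.coe_toReal (h.trans (EReal.coe_lt_top _)).ne
          ((EReal.bot_lt_coe _).trans_le hAS).ne').symm⟩
      have hF := hσ.finish_le_copyStart_add_MLup hc
      rw [hS] at h hAS hF
      have hS1 := EReal.coe_le_coe_iff.1 hAS
      have hS2 := EReal.coe_lt_coe_iff.1 h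
      have h1 := hσ.copy_wait_le hc hA hS1 hS.ge
      -- The actual bus use on the shorter window is enlarged to the window of length `x`; this
      -- replaces monotonicity of `MW` in its duration.
      have h2 : ∑ i ∈ τ.hp k, volume.real (σ.busTimes τ i ∩ Set.Ico A S)
          ≤ ∑ i ∈ τ.hp k, volume.real (σ.busTimes τ i ∩ Set.Ico A (A + x)) :=
        Finset.sum_le_sum fun i _ => volume_real_inter_Ico_mono
          (Set.inter_subset_inter_right _ (Set.Ico_subset_Ico_right hS2.le))
      refine hF.trans ?_
      rw [← EReal.coe_add, EReal.coe_le_coe_iff]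
      linarith

lemma jobFinish_le_R1 {a : ℕ} (ha : (a : ℕ∞) < σ.numJobs k)
    (h0 : σ.avail τ k a 0 = (σ.release k a : EReal)) :
    σ.jobFinish τ k a ≤ (σ.release k a : EReal) + τ.R1 k := by
  have hm := (τ.task k).m_pos
  set b : ℕ → EReal :=
    atPosition (τ.CRup k) (τ.MRup k) (fun j => (τ.GRup k j : EReal)) with hb
  have hstep : ∀ p ≤ 4 * ((τ.task k).m - 1), σ.finish k a p ≤ σ.avail τ k a p + b p := by
    intro p hp
    rcases position_cases hm hp with ⟨j, hj, rfl⟩ | ⟨j, hj, rfl⟩ | ⟨j, hj, rfl⟩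
    · rw [hb, atPosition_cpu]
      exact hσ.cpu_finish_le_CRup hdl ha hj
    · rw [hb, atPosition_gpu]
      exact hσ.finish_le_avail_add_GRup ha hj
    · rw [hb, atPosition_copy]
      exact hσ.copy_finish_le_MRup hdl ⟨ha, hj⟩
  have hsum : ∀ p ≤ 4 * ((τ.task k).m - 1),
      σ.finish k a p ≤ (σ.release k a : EReal) + ∑ q ∈ Finset.range (p + 1), b q := by
    intro p
    induction p with
    | zero =>
      intro hp
      simpa [h0] using hstep 0 hp
    | succ p ih =>
      intro hp
      refine (hstep _ hp).trans ?_
      rw [avail_succ, Finset.sum_range_succ, ← add_assoc]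
      exact add_le_add_left (ih (by omega)) _
  refine (hsum _ le_rfl).trans (le_of_eq ?_)
  congr 1
  rw [hb, sum_atPosition, R1, show (τ.task k).m - 1 + 1 = (τ.task k).m by omega,
    show 2 * ((τ.task k).m - 1) = 2 * (τ.task k).m - 2 by omega]
  congr 2
  exact (map_sum (⟨⟨Real.toEReal, EReal.coe_zero⟩, EReal.coe_add⟩ : ℝ →+ EReal) _ _).symm

lemma jobFinish_le_R2 {a : ℕ} (ha : (a : ℕ∞) < σ.numJobs k)
    (h0 : σ.avail τ k a 0 = (σ.release k a : EReal)) :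
    σ.jobFinish τ k a ≤ (σ.release k a : EReal) + τ.R2 k := by
  have hm := (τ.task k).m_pos
  refine le_add_leastSolution fun x hx hsol => ?_
  have hMR0 : ∀ j, 0 ≤ τ.MRup k j := fun j => leastSolution_nonneg _
  -- An infinite copy bound would make the right-hand side of the equation `⊤`, which the real
  -- number `x` cannot equal.
  have hMRtop : ∀ j < 2 * (τ.task k).m - 2, τ.MRup k j ≠ ⊤ := by
    intro j hj htop
    have h1 := Finset.single_le_sum (f := fun j => τ.MRup k j) (fun j _ => hMR0 j)
      (Finset.mem_range.2 hj)
    rw [htop, top_le_iff] at h1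
    rw [h1] at hsol
    simp at hsol
  obtain ⟨mr, hmr⟩ : ∃ mr : ℕ → ℝ, ∀ j < 2 * (τ.task k).m - 2, τ.MRup k j = mr j :=
    ⟨fun j => (τ.MRup k j).toReal, fun j hj => (EReal.coe_toReal (hMRtop j hj)
      (EReal.bot_lt_zero.trans_le (hMR0 j)).ne').symm⟩
  have hsumMR : ∑ j ∈ Finset.range (2 * (τ.task k).m - 2), τ.MRup k j
      = ((∑ j ∈ Finset.range (2 * (τ.task k).m - 2), mr j : ℝ) : EReal) := by
    rw [Finset.sum_congr rfl fun j hj => hmr j (Finset.mem_range.1 hj)]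
    exact (map_sum (⟨⟨Real.toEReal, EReal.coe_zero⟩, EReal.coe_add⟩ : ℝ →+ EReal) _ _).symm
  rw [hsumMR] at hsol
  set b : ℕ → ℝ := atPosition (τ.task k).CLup mr (τ.GRup k) with hb
  have hsol' : x = ∑ p ∈ Finset.range (4 * ((τ.task k).m - 1) + 1), b p
      + τ.cpuInterference k x := by
    rw [hb, sum_atPosition, show (τ.task k).m - 1 + 1 = (τ.task k).m by omega,
      show 2 * ((τ.task k).m - 1) = 2 * (τ.task k).m - 2 by omega]
    exact_mod_cast hsol
  have hb0 : ∀ p ≤ 4 * ((τ.task k).m - 1), 0 ≤ b p := by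
    intro p hp
    rcases position_cases hm hp with ⟨j, hj, rfl⟩ | ⟨j, hj, rfl⟩ | ⟨j, hj, rfl⟩
    · rw [hb, atPosition_cpu]
      have := (τ.task k).CL_bounds j hj
      exact this.1.trans this.2
    · rw [hb, atPosition_gpu]
      exact τ.GRup_nonneg hj
    · rw [hb, atPosition_copy]
      have := hMR0 j
      rw [hmr j hj] at this
      exact EReal.coe_nonneg.1 this
  have hpart : ∀ p ≤ 4 * ((τ.task k).m - 1), ∑ q ∈ Finset.range (p + 1), b q
      ≤ ∑ q ∈ Finset.range (4 * ((τ.task k).m - 1) + 1), b q := fun p hp =>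
    Finset.sum_le_sum_of_subset_of_nonneg (Finset.range_mono (by omega)) fun q hq _ =>
      hb0 q (by have := Finset.mem_range.1 hq; omega)
  set r := σ.release k a with hr
  have hdem := hσ.hp_demand_le hdl r hx
  -- The invariant along the job: elapsed time is at most the bounds `b` of the completed segments
  -- plus the higher-priority CPU time since the release `r`, and everything so far lies within `r +
  -- x`. Higher-priority time during copies and GPU segments is included harmlessly, as the total is
  -- charged only once.
  have hstep : ∀ p ≤ 4 * ((τ.task k).m - 1), ∀ A : ℝ, σ.avail τ k a p = A → r ≤ A → A ≤ r + x →
      A ≤ r + ∑ q ∈ Finset.range p, b q + volume.real (σ.hpTimes τ k ∩ Set.Ico r A) →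
      ∃ F : ℝ, σ.finish k a p = F ∧ A ≤ F ∧ F ≤ r + x ∧
        F ≤ r + ∑ q ∈ Finset.range (p + 1), b q
          + volume.real (σ.hpTimes τ k ∩ Set.Ico r F) := by
    intro p hp A hA hrA hAx hAle
    have hAF := hσ.avail_le_finish ha hp
    rw [hA] at hAF
    have hAQ := volume_hpTimes_mono (σ := σ) (τ := τ) (k := k) (r := r) hAx
    have htot := hpart p hp
    have hreal : ∀ y : ℝ, σ.finish k a p ≤ y → ∃ F : ℝ, σ.finish k a p = F ∧ A ≤ F ∧ F ≤ y := by
      intro y hy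
      obtain ⟨F, hF⟩ : ∃ F : ℝ, σ.finish k a p = F :=
        ⟨_, (EReal.coe_toReal (hy.trans_lt (EReal.coe_lt_top _)).ne
          ((EReal.bot_lt_coe _).trans_le hAF).ne').symm⟩
      rw [hF] at hy hAF
      exact ⟨F, hF, EReal.coe_le_coe_iff.1 hAF, EReal.coe_le_coe_iff.1 hy⟩
    have hother : σ.finish k a p ≤ (A : EReal) + (b p : EReal) →
        ∃ F : ℝ, σ.finish k a p = F ∧ A ≤ F ∧ F ≤ r + x ∧
          F ≤ r + ∑ q ∈ Finset.range (p + 1), b q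
            + volume.real (σ.hpTimes τ k ∩ Set.Ico r F) := by
      intro h
      rw [← EReal.coe_add] at h
      obtain ⟨F, hF, h1, h2⟩ := hreal _ h
      have h3 := volume_hpTimes_mono (σ := σ) (τ := τ) (k := k) (r := r) h1
      rw [Finset.sum_range_succ] at htot ⊢
      exact ⟨F, hF, h1, by linarith, by linarith⟩
    rcases position_cases hm hp with ⟨j, hj, rfl⟩ | ⟨j, hj, rfl⟩ | ⟨j, hj, rfl⟩
    · have hbj : b (4 * j) = (τ.task k).CLup j := by rw [hb, atPosition_cpu]
      -- Were the segment unfinished at `r + x`, adding its strict elapsed-time bound to the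
      -- invariant would give `x` strictly less than `∑ b` plus the interference over `x`, which is
      -- `x` itself.
      have hfx : σ.finish k a (4 * j) ≤ ((r + x : ℝ) : EReal) := by
        by_contra hcon
        have h1 := hσ.cpu_elapsed_lt ha hj hA hAx (not_le.1 hcon)
        have h2 := volume_hpTimes_add (σ := σ) (τ := τ) (k := k) hrA hAx
        rw [Finset.sum_range_succ] at htot
        linarith
      obtain ⟨F, hF, h1, h2⟩ := hreal _ hfx
      have h3 := hσ.cpu_elapsed_le ha hj hA h1 hF
      have h4 := volume_hpTimes_add (σ := σ) (τ := τ) (k := k) hrA h1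
      rw [Finset.sum_range_succ]
      exact ⟨F, hF, h1, h2, by linarith⟩
    · refine hother ?_
      rw [hb, atPosition_gpu, ← hA]
      exact hσ.finish_le_avail_add_GRup ha hj
    · refine hother ?_
      rw [hb, atPosition_copy, ← hA, ← hmr j hj]
      exact hσ.copy_finish_le_MRup hdl ⟨ha, hj⟩
  have hall : ∀ p ≤ 4 * ((τ.task k).m - 1), ∃ F : ℝ, σ.finish k a p = F ∧ r ≤ F ∧ F ≤ r + x ∧
      F ≤ r + ∑ q ∈ Finset.range (p + 1), b q
        + volume.real (σ.hpTimes τ k ∩ Set.Ico r F) := by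
    intro p
    induction p with
    | zero =>
      intro hp
      obtain ⟨F, hF, h1, h2, h3⟩ := hstep 0 hp r h0 le_rfl (by linarith) (by simp)
      exact ⟨F, hF, h1, h2, h3⟩
    | succ p ih =>
      intro hp
      obtain ⟨A, hA, h1, h2, h3⟩ := ih (by omega)
      obtain ⟨F, hF, h4, h5, h6⟩ := hstep (p + 1) hp A (by rw [avail_succ, hA]) h1 h2 h3
      exact ⟨F, hF, h1.trans h4, h5, h6⟩
  obtain ⟨F, hF, -, h2, -⟩ := hall _ le_rfl
  rw [jobFinish, hF, EReal.coe_le_coe_iff]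
  exact h2

/-- A job whose predecessor is completed when it is released finishes within the response time
bound. -/
theorem jobFinish_le_R {a : ℕ} (ha : (a : ℕ∞) < σ.numJobs k)
    (hpred : ∀ b : ℕ, a = b + 1 → σ.jobFinish τ k b ≤ (σ.release k a : EReal)) :
    σ.jobFinish τ k a ≤ (σ.release k a : EReal) + τ.R k := by
  have h0 : σ.avail τ k a 0 = (σ.release k a : EReal) := by
    cases a with
    | zero => rfl
    | succ b => exact max_eq_left (hpred b rfl)
  rcases min_choice (τ.R1 k) (τ.R2 k) with h | h
  · rw [R, h]
    exact hσ.jobFinish_le_R1 hdl ha h0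
  · rw [R, h]
    exact hσ.jobFinish_le_R2 hdl ha h0

end HigherPriorityDeadlines

end Legal

end Run

end RTGPU

theorem mainTheorem1 {n : ℕ} (τ : RTGPU.TaskSystem n) (σ : RTGPU.Run n) (hσ : σ.Legal τ)
    (k : Fin n) (hdl : ∀ i ∈ τ.hp k, σ.MeetsDeadlines τ i) :
    -- every job whose predecessor is completed when it is released
    (∀ a : ℕ, (a : ℕ∞) < σ.numJobs k →
      (∀ b : ℕ, a = b + 1 → σ.jobFinish τ k b ≤ (σ.release k a : EReal)) →
      σ.jobFinish τ k a ≤ (σ.release k a : EReal) + τ.R k) ∧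
    -- every job, if the bound does not exceed the minimum inter-arrival time
    (τ.R k ≤ ((τ.task k).T : EReal) →
      ∀ a : ℕ, (a : ℕ∞) < σ.numJobs k →
        σ.jobFinish τ k a ≤ (σ.release k a : EReal) + τ.R k) := by
  refine ⟨fun a ha hpred => hσ.jobFinish_le_R hdl ha hpred, fun hR a => ?_⟩
  induction a with
  | zero => exact fun ha => hσ.jobFinish_le_R hdl ha fun b hb => absurd hb (by omega)
  | succ a ih =>
    intro ha
    refine hσ.jobFinish_le_R hdl ha fun b hb => ?_
    obtain rfl : a = b := by omega
    -- The predecessor finishes within `R ≤ T` of its release, hence by the next release, so the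
    -- single-job bound applies again.
    refine (ih (lt_of_le_of_lt (by exact_mod_cast Nat.le_succ _) ha)).trans
      ((add_le_add_right hR _).trans ?_)
    rw [← EReal.coe_add, EReal.coe_le_coe_iff]
    exact hσ.sporadic k a ha
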